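/- Let $n,k$ be natural numbers and let $M$ be a Hausdorff smooth manifold (without boundary) of dimension $n(k+1)$. Let $(\omega_1,\dots,\omega_k,\mathcal F)$ be a $k$-symplectic structure on $M$: the $\omega_\alpha$ are closed smooth $2$-forms, $\mathcal F$ is an $nk$-dimensional foliation with tangent distribution $L=T\mathcal F$, every $\omega_\alpha$ satisfies $\omega_\alpha(X,X')=0$ for all $X,X'\in\Gamma(L)$, and $C_x(\omega_1)\cap\dots\cap C_x(\omega_k)=\{0\}$ for every $x\in M$, where $C_x(\omega)=\{v\in T_xM:\omega_x(v,w)=0 \text{ for all } w\in T_xM\}$. For $1\le\alpha\le k$ put $L_\alpha=L\cap\bigcap_{\beta\ne\alpha}C(\omega_\beta)$; for $k\ge 2$ this equals $\bigcap_{\beta\neq\alpha}C(\omega_\beta)$, and for $k=1$ it is $L_1=L$. Let $Q$ be a smooth integrable distribution of rank $n$ with $TM=L\oplus Q$ such that (i) $\omega_\alpha(Y,Y')=0$ for all $Y,Y'\in\Gamma(Q)$ and all $\alpha$; (ii) $[X,Y]\in\Gamma(L_\alpha\oplus Q)$ for all $\alpha$, all $X\in\Gamma(L_\alpha)$ and all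 $Y\in\Gamma(Q)$. For $Y,Y'\in\Gamma(Q)$ let $\psi_\alpha^{YY'}$ be the map $V\mapsto(\mathcal L_Y i_{Y'}\omega_\alpha)(V)=Y(\omega_\alpha(Y',V))-\omega_\alpha(Y',[Y,V])$, regarded as a section of $L_\alpha^*$, and let $i_\alpha^*:Q\to L_\alpha^*$ be the isomorphism $i_\alpha^*(Z)(X)=\omega_\alpha(Z,X)$. Assume that $$(i_1^*)^{-1}(\psi_1^{YY'})=\dots=(i_k^*)^{-1}(\psi_k^{YY'})\qquad\text{for all } Y,Y'\in\Gamma(Q).$$ Then there exists a unique linear connection $\nabla$ on $M$ such that (1) $\nabla_V X\in\Gamma(L_\alpha)$ for all $\alpha$, $V\in\Gamma(TM)$, $X\in\Gamma(L_\alpha)$, and $\nabla_V Y\in\Gamma(Q)$ for all $V\in\Gamma(TM)$, $Y\in\Gamma(Q)$; (2) $\nabla\omega_1=\dots=\nabla\omega_k=0$; (3) $T(X,Y)=0$ for all $X\in\Gamma(L)$ and $Y\in\Gamma(Q)$, where $T(X,Y)=\nabla_XY-\nabla_YX-[X,Y]$ is the torsion of $\nabla$. -/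

import Mathlib

open scoped Manifold ContDiff

noncomputable section

namespace KSymplectic

variable (E : Type*) [NormedAddCommGroup E] [NormedSpace ℝ E]
  (M : Type*) [TopologicalSpace M] [ChartedSpace E M] [IsManifold 𝓘(ℝ, E) ∞ M]

/-- `Γ(TM)`: the smooth vector fields on a smooth manifold `M` modelled on `E`. -/
abbrev VField : Type _ :=
  ContMDiffSection 𝓘(ℝ, E) E ∞ (fun x : M => TangentSpace 𝓘(ℝ, E) x)

/-- `C^∞(M)`: the smooth real-valued functions on `M`. -/
abbrev SmoothFun : Type _ := ContMDiffMap 𝓘(ℝ, E) 𝓘(ℝ, ℝ) M ℝ ∞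

variable {E M}

/-- The Lie bracket `[X, Y]` of two vector fields at the point `x`. -/
def bracket (X Y : VField E M) (x : M) : TangentSpace 𝓘(ℝ, E) x :=
  VectorField.mlieBracket 𝓘(ℝ, E) X Y x

/-- The derivative `X(f)` of a function `f` along the vector field `X`, at the point `x`. -/
def dirDeriv (X : VField E M) (f : M → ℝ) (x : M) : ℝ :=
  mfderiv 𝓘(ℝ, E) 𝓘(ℝ, ℝ) f x (X x)

/-- The product `f X` of a smooth function and a smooth vector field. -/
def fsmul (f : SmoothFun E M) (X : VField E M) : VField E M :=
  ⟨fun x => f x • X x, f.contMDiff.smul_section X.contMDiff⟩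

/-- `X ∈ Γ(D)`: the vector field `X` is a section of the field of subspaces `D`. -/
def IsSectionOf (D : ∀ x : M, Submodule ℝ (TangentSpace 𝓘(ℝ, E) x)) (X : VField E M) : Prop :=
  ∀ x, X x ∈ D x

variable (E M)

/-- A smooth distribution of rank `r`: a subspace of every tangent space, spanned near every
point by `r` smooth, pointwise linearly independent local vector fields. -/
structure Distribution (r : ℕ) where
  /-- The subspace of the tangent space at `x`. -/
  fiber : ∀ x : M, Submodule ℝ (TangentSpace 𝓘(ℝ, E) x)
  exists_local_frame : ∀ x₀ : M, ∃ U : Set M, IsOpen U ∧ x₀ ∈ U ∧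
    ∃ s : Fin r → ∀ x : M, TangentSpace 𝓘(ℝ, E) x,
      (∀ i, ContMDiffOn 𝓘(ℝ, E) 𝓘(ℝ, E).tangent ∞
        (fun x => (⟨x, s i x⟩ : TangentBundle 𝓘(ℝ, E) M)) U) ∧
      ∀ y ∈ U, LinearIndependent ℝ (fun i => s i y) ∧
        Submodule.span ℝ (Set.range fun i => s i y) = fiber y

/-- A smooth differential `2`-form on `M`: a smooth section of the bundle of bilinear forms on
the tangent spaces which is alternating at every point. -/
structure TwoForm where
  /-- The bilinear form on the tangent space at `x`. -/
  toFun : ∀ x : M, TangentSpace 𝓘(ℝ, E) x →L[ℝ] TangentSpace 𝓘(ℝ, E) x →L[ℝ] ℝ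
  alternating : ∀ (x : M) (v : TangentSpace 𝓘(ℝ, E) x), toFun x v v = 0
  contMDiff : ContMDiff 𝓘(ℝ, E) (𝓘(ℝ, E).prod 𝓘(ℝ, E →L[ℝ] E →L[ℝ] ℝ)) ∞
    (fun x => Bundle.TotalSpace.mk' (E →L[ℝ] E →L[ℝ] ℝ)
      (E := fun x : M => TangentSpace 𝓘(ℝ, E) x →L[ℝ] TangentSpace 𝓘(ℝ, E) x →L[ℝ] ℝ)
      x (toFun x))

/-- A linear connection on `M` (a covariant derivative `(V, W) ↦ ∇_V W` on the smooth vector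
fields): additive in both arguments, `C^∞(M)`-linear in `V`, and satisfying the Leibniz rule
`∇_V (f W) = f ∇_V W + V(f) W` in `W`. -/
structure LinearConnection where
  /-- `cov V W` is `∇_V W`. -/
  cov : VField E M → VField E M → VField E M
  add_left : ∀ V V' W, cov (V + V') W = cov V W + cov V' W
  smul_left : ∀ (f : SmoothFun E M) V W, cov (fsmul f V) W = fsmul f (cov V W)
  add_right : ∀ V W W', cov V (W + W') = cov V W + cov V W'
  leibniz : ∀ (f : SmoothFun E M) (V W : VField E M) (x : M),
    cov V (fsmul f W) x = f x • cov V W x + dirDeriv V f x • W x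

variable {E M}

/-- Integrability of a distribution, in the involutive form (Frobenius): `Γ(D)` is closed under
the Lie bracket. Integrable distributions are the tangent distributions `T𝓕` of foliations. -/
def Distribution.IsIntegrable {r : ℕ} (D : Distribution E M r) : Prop :=
  ∀ X Y : VField E M, IsSectionOf D.fiber X → IsSectionOf D.fiber Y →
    ∀ x, bracket X Y x ∈ D.fiber x

namespace TwoForm

/-- The function `ω(X, Y)`. -/
def eval (Ω : TwoForm E M) (X Y : VField E M) : M → ℝ := fun x => Ω.toFun x (X x) (Y x)

/-- `dω = 0`, through the invariant formula for the exterior derivative: the sum over the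
cyclic permutations of `(X, Y, Z)` of `X(ω(Y, Z)) - ω([X, Y], Z)` vanishes. -/
def IsClosed (Ω : TwoForm E M) : Prop :=
  ∀ (X Y Z : VField E M) (x : M),
    dirDeriv X (Ω.eval Y Z) x + dirDeriv Y (Ω.eval Z X) x + dirDeriv Z (Ω.eval X Y) x
      - Ω.toFun x (bracket X Y x) (Z x) - Ω.toFun x (bracket Y Z x) (X x)
      - Ω.toFun x (bracket Z X x) (Y x) = 0

/-- The characteristic space `C_x(ω) = {v | ω_x(v, w) = 0 for all w}`. -/
def charSpace (Ω : TwoForm E M) (x : M) : Submodule ℝ (TangentSpace 𝓘(ℝ, E) x) :=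
  LinearMap.ker (Ω.toFun x).toLinearMap

/-- `ω` vanishes on `D`: `ω(v, w) = 0` for all `v, w` in the same space `D x`. -/
def VanishesOn (Ω : TwoForm E M) (D : ∀ x : M, Submodule ℝ (TangentSpace 𝓘(ℝ, E) x)) : Prop :=
  ∀ x, ∀ v ∈ D x, ∀ w ∈ D x, Ω.toFun x v w = 0

/-- The function `(𝓛_Y i_{Y'} ω)(V) = Y(ω(Y', V)) - ω(Y', [Y, V])`. -/
def psi (Ω : TwoForm E M) (Y Y' V : VField E M) (x : M) : ℝ :=
  dirDeriv Y (Ω.eval Y' V) x - Ω.toFun x (Y' x) (bracket Y V x)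

end TwoForm

variable (E M) in
/-- A `k`-symplectic structure on a manifold of dimension `n (k + 1)`: closed `2`-forms
`ω₁, …, ω_k` whose characteristic spaces have zero intersection, and a foliation of dimension
`n k`, given by its (integrable) tangent distribution `L`, on which all `ω_α` vanish. -/
structure Structure (n k : ℕ) where
  dim_eq : Module.finrank ℝ E = n * (k + 1)
  /-- The `2`-forms `ω_α`. -/
  form : Fin k → TwoForm E M
  closed : ∀ α, (form α).IsClosed
  /-- The tangent distribution `L = T𝓕` of the foliation `𝓕`. -/
  L : Distribution E M (n * k)
  integrable : L.IsIntegrable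
  iInf_charSpace : ∀ x, ⨅ α, (form α).charSpace x = ⊥
  vanishesOn : ∀ α, (form α).VanishesOn L.fiber

namespace Structure

variable {n k : ℕ} (S : Structure E M n k)

/-- `L_α = ⋂_{β ≠ α} C(ω_β)`. The intersection with `L` matters only for `k = 1`, where it gives
`L_1 = L`; it is redundant for `k ≥ 2`, see `leaf_eq_iInf`. -/
def leaf (α : Fin k) (x : M) : Submodule ℝ (TangentSpace 𝓘(ℝ, E) x) :=
  S.L.fiber x ⊓ ⨅ (β : Fin k) (_ : β ≠ α), (S.form β).charSpace x

/-- `Z = (i*_α)⁻¹(ψ_α^{YY'})`, where `i*_α : Q → L_α^*` is `i*_α(Z)(X) = ω_α(Z, X)`: the vector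
field `Z` is a section of `Q` with `ω_α(Z, X) = ψ_α^{YY'}(X)` for all `X ∈ Γ(L_α)`. -/
def IsPreimagePsi (Q : Distribution E M n) (α : Fin k) (Y Y' Z : VField E M) : Prop :=
  IsSectionOf Q.fiber Z ∧ ∀ X : VField E M, IsSectionOf (S.leaf α) X →
    ∀ x, (S.form α).eval Z X x = (S.form α).psi Y Y' X x

end Structure

namespace LinearConnection

variable (C : LinearConnection E M)

/-- `∇ D ⊂ D`: if `W` is a section of `D`, then so is `∇_V W`, for every vector field `V`. -/
def Preserves (D : ∀ x : M, Submodule ℝ (TangentSpace 𝓘(ℝ, E) x)) : Prop :=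
  ∀ V W : VField E M, IsSectionOf D W → IsSectionOf D (C.cov V W)

/-- `(∇_V ω)(W, W') = V(ω(W, W')) - ω(∇_V W, W') - ω(W, ∇_V W')`. -/
def covTwoForm (Ω : TwoForm E M) (V W W' : VField E M) (x : M) : ℝ :=
  dirDeriv V (Ω.eval W W') x - Ω.eval (C.cov V W) W' x - Ω.eval W (C.cov V W') x

/-- The torsion `T(X, Y) = ∇_X Y - ∇_Y X - [X, Y]`. -/
def torsion (X Y : VField E M) (x : M) : TangentSpace 𝓘(ℝ, E) x :=
  C.cov X Y x - C.cov Y X x - bracket X Y x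

end LinearConnection

/-- Linear algebra: for alternating forms `B_β` without common kernel which vanish on a subspace
`L`, with the dimensions as above, every kernel is contained in `L`. -/
theorem ker_le_of_dim {V : Type*} [AddCommGroup V] [Module ℝ V] [FiniteDimensional ℝ V]
    {n k : ℕ} (hV : Module.finrank ℝ V = n * (k + 1)) (B : Fin k → V →ₗ[ℝ] Module.Dual ℝ V)
    (L : Submodule ℝ V) (hL : Module.finrank ℝ L = n * k)
    (hB : ⨅ β, LinearMap.ker (B β) = ⊥) (halt : ∀ β v, B β v v = 0)
    (hLB : ∀ β, ∀ v ∈ L, ∀ w ∈ L, B β v w = 0) (β : Fin k) : LinearMap.ker (B β) ≤ L := by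
  have hswap : ∀ γ v w, B γ v w = - B γ w v := fun γ v w => by
    have h := halt γ (v + w)
    simp only [map_add, LinearMap.add_apply, halt, zero_add, add_zero] at h
    linarith
  have hq : Module.finrank ℝ (V ⧸ L) = n := by
    have h := L.finrank_quotient_add_finrank
    have h' : n * (k + 1) = n * k + n := by ring
    omega
  let f : L →ₗ[ℝ] (Fin k → Module.Dual ℝ (V ⧸ L)) := LinearMap.pi fun γ =>
    { toFun := fun X => L.liftQ (B γ X) fun w hw => hLB γ X X.2 w hw
      map_add' := fun X Y => by ext w; simp; rfl
      map_smul' := fun c X => by ext w; simp; exact Or.inl rfl }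
  have hf : ∀ X γ w, f X γ (L.mkQ w) = B γ X w := fun X γ w => rfl
  have hinj : Function.Injective f := by
    rw [← LinearMap.ker_eq_bot, LinearMap.ker_eq_bot']
    intro X hX
    have h0 : (X : V) ∈ ⨅ γ, LinearMap.ker (B γ) := by
      rw [Submodule.mem_iInf]
      intro γ
      refine LinearMap.ext fun w => ?_
      rw [← hf, hX]
      rfl
    rw [hB] at h0
    exact Subtype.ext ((Submodule.mem_bot ℝ).1 h0)
  have hdim : Module.finrank ℝ L = Module.finrank ℝ (Fin k → Module.Dual ℝ (V ⧸ L)) := by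
    rw [Module.finrank_pi_fintype, hL]
    simp [Subspace.dual_finrank_eq, hq, mul_comm]
  have hsurj : Function.Surjective f :=
    (LinearMap.injective_iff_surjective_of_finrank_eq_finrank hdim).1 hinj
  intro v hv
  rw [← Submodule.Quotient.mk_eq_zero, ← Module.forall_dual_apply_eq_zero_iff ℝ]
  intro ξ
  obtain ⟨X, hX⟩ := hsurj (fun _ => ξ)
  have h1 : ξ (L.mkQ v) = B β X v := by rw [← hf, hX]
  have h2 : B β v = 0 := hv
  exact h1.trans (by rw [hswap, h2]; simp)

/-- For `k ≥ 2`, `L_α` is the intersection of the spaces `C(ω_β)`, `β ≠ α`. -/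
theorem Structure.leaf_eq_iInf [FiniteDimensional ℝ E] {n k : ℕ} (S : Structure E M n k)
    (hk : 2 ≤ k) (α : Fin k) (x : M) :
    S.leaf α x = ⨅ (β : Fin k) (_ : β ≠ α), (S.form β).charSpace x := by
  refine inf_eq_right.2 ?_
  have : Nontrivial (Fin k) := Fin.nontrivial_iff_two_le.2 hk
  obtain ⟨β, hβ⟩ := exists_ne α
  refine (iInf₂_le β hβ).trans ?_
  have : FiniteDimensional ℝ (TangentSpace 𝓘(ℝ, E) x) := inferInstanceAs (FiniteDimensional ℝ E)
  have hL : Module.finrank ℝ (S.L.fiber x) = n * k := by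
    obtain ⟨U, -, hx, s, -, hs⟩ := S.L.exists_local_frame x
    rw [← (hs x hx).2, finrank_span_eq_card (hs x hx).1, Fintype.card_fin]
  let B : Fin k → TangentSpace 𝓘(ℝ, E) x →ₗ[ℝ] Module.Dual ℝ (TangentSpace 𝓘(ℝ, E) x) := fun γ =>
    { toFun := fun v => ((S.form γ).toFun x v).toLinearMap
      map_add' := fun v w => by simp
      map_smul' := fun c v => by simp }
  have hker : ∀ γ, LinearMap.ker (B γ) = (S.form γ).charSpace x := by
    intro γ
    ext v
    constructor
    · intro h
      exact ContinuousLinearMap.ext fun w => LinearMap.congr_fun (show B γ v = 0 from h) w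
    · intro h
      have h' : (S.form γ).toFun x v = 0 := h
      exact LinearMap.ext fun w => by
        change (S.form γ).toFun x v w = 0
        rw [h']; rfl
  rw [← hker β]
  refine ker_le_of_dim S.dim_eq B (S.L.fiber x) hL
    ((iInf_congr hker).trans (S.iInf_charSpace x)) (fun γ v => (S.form γ).alternating x v)
    (fun γ v hv w hw => S.vanishesOn γ x v hv w hw) β

end KSymplectic

end

/-!
The tangent bundle splits as `L ⊕ Q`, both summands being isotropic for all the `ω_α`, which have no
common kernel. So a vector field `U` is determined by the functions `ω_α(U, Y)` with `Y ∈ Γ(Q)` and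
`ω_α(U, X)` with `X ∈ Γ(L)`. Write `V_L`, `V_Q` for the components of `V`, and
`ψ_α(X, Y, V) = X(ω_α(Y, V)) - ω_α(Y, [X, V])`. The conditions on `∇` force `U = ∇_V W` to satisfy
the equations (`IsCov`)

* `ω_α(U, Y) = ψ_α(V_L, W_L, Y) + ω_α([V_Q, W_L], Y)` for all `Y ∈ Γ(Q)`,
* `ω_α(U, X) = ψ_α(V_Q, W_Q, X) + ω_α([V_L, W_Q], X)` for all `X ∈ Γ(L)`:

the torsion condition gives `∇_X Y` and `∇_Y X`, for `X ∈ Γ(L)` and `Y ∈ Γ(Q)`, as the components of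
`±[X, Y]`, and `∇ω_α = 0` then gives the derivatives of sections of `L` along `L`, and of `Q`
along `Q` (`isCov_of_properties`). This is uniqueness. Conversely the equations have a
solution (`exists_isCov`); the solutions form a connection, by the Leibniz rules for `ψ_α` and the
bracket and by isotropy, and this connection has the required properties. Condition
(ii) gives `∇ L_α ⊂ L_α`.

The equations are solved summand by summand. The functional `ψ_α(X, Y, ·)` is `C^∞(M)`-linear,
hence given by a linear form at every point (`exists_linearMap_of_tensorial`). By the dimensions,
`X ↦ (ω_α(X, ·)|_Q)_α` is an isomorphism from `L` to `(Q^*)^k` (`exists_linearEquiv_pi_dual`), under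
which `L_α` corresponds to the summand with index `α`. So every `k`-tuple of functionals on `Q`
comes from a section of `L` (`exists_section_L`), and `L` is the sum of the `L_α`
(`exists_eq_sum_leaf`). A section of `Q` can represent a given functional on one of the
`L_α` only (`exists_section_Q`); that the functionals `ψ_α(Y, Y', ·)` on all the `L_α`
come from the same section of `Q` is the hypothesis on the `(i_α^*)⁻¹ ψ_α^{YY'}` (`exists_section_Q_psi`).

Fields constructed pointwise are smooth because they solve invertible linear systems with smooth
coefficients (`contMDiff_of_separating`).
-/

namespace KSymplectic

open Filter Topology

section Calculus

variable {E : Type*} [NormedAddCommGroup E] [NormedSpace ℝ E]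
  {M : Type*} [TopologicalSpace M] [ChartedSpace E M] [IsManifold 𝓘(ℝ, E) ∞ M]

/-! ### Derivatives, brackets and `2`-forms -/

@[simp] lemma fsmul_apply (f : SmoothFun E M) (X : VField E M) (x : M) :
    fsmul f X x = f x • X x := rfl

lemma VField.add_apply (X Y : VField E M) (x : M) : (X + Y) x = X x + Y x := rfl

lemma VField.sub_apply (X Y : VField E M) (x : M) : (X - Y) x = X x - Y x := rfl

lemma VField.mdifferentiableAt (X : VField E M) (x : M) :
    MDifferentiableAt 𝓘(ℝ, E) 𝓘(ℝ, E).tangent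
      (fun x => (⟨x, X x⟩ : TangentBundle 𝓘(ℝ, E) M)) x :=
  (X.contMDiff x).mdifferentiableAt (by simp)

lemma dirDeriv_add_left (X Y : VField E M) (f : M → ℝ) (x : M) :
    dirDeriv (X + Y) f x = dirDeriv X f x + dirDeriv Y f x :=
  (mfderiv 𝓘(ℝ, E) 𝓘(ℝ, ℝ) f x).map_add (X x) (Y x)

lemma dirDeriv_fsmul_left (g : SmoothFun E M) (X : VField E M) (f : M → ℝ) (x : M) :
    dirDeriv (fsmul g X) f x = g x * dirDeriv X f x :=
  (mfderiv 𝓘(ℝ, E) 𝓘(ℝ, ℝ) f x).map_smul (g x) (X x)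

lemma dirDeriv_eq_mvfderiv (X : VField E M) (f : M → ℝ) (x : M) :
    dirDeriv X f x = mvfderiv 𝓘(ℝ, E) f x (X x) := rfl

lemma dirDeriv_add {f g : M → ℝ} (hf : ContMDiff 𝓘(ℝ, E) 𝓘(ℝ, ℝ) ∞ f)
    (hg : ContMDiff 𝓘(ℝ, E) 𝓘(ℝ, ℝ) ∞ g) (X : VField E M) (x : M) :
    dirDeriv X (fun x => f x + g x) x = dirDeriv X f x + dirDeriv X g x := by
  simp only [dirDeriv_eq_mvfderiv]
  have := mvfderiv_add ((hf x).mdifferentiableAt (by simp)) ((hg x).mdifferentiableAt (by simp))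
  exact congrArg (fun T => T (X x)) this

lemma dirDeriv_mul {f g : M → ℝ} (hf : ContMDiff 𝓘(ℝ, E) 𝓘(ℝ, ℝ) ∞ f)
    (hg : ContMDiff 𝓘(ℝ, E) 𝓘(ℝ, ℝ) ∞ g) (X : VField E M) (x : M) :
    dirDeriv X (fun x => f x * g x) x = f x * dirDeriv X g x + dirDeriv X f x * g x := by
  simp only [dirDeriv_eq_mvfderiv]
  have := mvfderiv_mul ((hf x).mdifferentiableAt (by simp)) ((hg x).mdifferentiableAt (by simp))
  refine (congrArg (fun T => T (X x)) this).trans ?_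
  simp [mul_comm]

lemma dirDeriv_zero (X : VField E M) (x : M) : dirDeriv X (fun _ => (0 : ℝ)) x = 0 := by
  rw [dirDeriv_eq_mvfderiv, mvfderiv_const]; rfl

lemma contMDiff_dirDeriv (X : VField E M) {f : M → ℝ}
    (hf : ContMDiff 𝓘(ℝ, E) 𝓘(ℝ, ℝ) ∞ f) :
    ContMDiff 𝓘(ℝ, E) 𝓘(ℝ, ℝ) ∞ (dirDeriv X f) :=
  (contMDiff_snd_tangentBundle_modelSpace ℝ 𝓘(ℝ, ℝ)).comp
    ((hf.contMDiff_tangentMap (m := ∞) (by simp)).comp X.contMDiff)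

/-- The derivative `X(f)` of a smooth function, as an element of `C^∞(M)`. -/
noncomputable def dirDerivFun (X : VField E M) (f : SmoothFun E M) : SmoothFun E M :=
  ⟨dirDeriv X f, contMDiff_dirDeriv X f.contMDiff⟩

lemma dirDerivFun_apply (X : VField E M) (f : SmoothFun E M) (x : M) :
    dirDerivFun X f x = dirDeriv X f x := rfl

lemma bracket_swap (X Y : VField E M) (x : M) : bracket X Y x = -bracket Y X x :=
  VectorField.mlieBracket_swap_apply

lemma bracket_add_right [CompleteSpace E] (X Y Z : VField E M) (x : M) :
    bracket X (Y + Z) x = bracket X Y x + bracket X Z x :=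
  VectorField.mlieBracket_add_right (Y.mdifferentiableAt x) (Z.mdifferentiableAt x)

lemma bracket_add_left [CompleteSpace E] (X Y Z : VField E M) (x : M) :
    bracket (X + Y) Z x = bracket X Z x + bracket Y Z x :=
  VectorField.mlieBracket_add_left (X.mdifferentiableAt x) (Y.mdifferentiableAt x)

lemma bracket_fsmul_right [CompleteSpace E] (f : SmoothFun E M) (X Y : VField E M) (x : M) :
    bracket X (fsmul f Y) x = dirDeriv X f x • Y x + f x • bracket X Y x :=
  VectorField.mlieBracket_smul_right ((f.contMDiff x).mdifferentiableAt (by simp))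
    (Y.mdifferentiableAt x)

lemma bracket_fsmul_left [CompleteSpace E] (f : SmoothFun E M) (X Y : VField E M) (x : M) :
    bracket (fsmul f X) Y x = f x • bracket X Y x - dirDeriv Y f x • X x := by
  rw [bracket_swap, bracket_fsmul_right, bracket_swap Y X, smul_neg]
  abel

/-- The Lie bracket of two vector fields, as a vector field. -/
noncomputable def lie [CompleteSpace E] (X Y : VField E M) : VField E M :=
  have : IsManifold 𝓘(ℝ, E) (((⊤ : ℕ∞) : WithTop ℕ∞) + 1) M := ‹IsManifold 𝓘(ℝ, E) ∞ M›
  have : IsManifold 𝓘(ℝ, E) (minSmoothness ℝ 2) M := by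
    rw [minSmoothness_of_isRCLikeNormedField]
    infer_instance
  ⟨bracket X Y,
    ContDiff.mlieBracket_vectorField (m := ⊤) (n := ⊤) X.contMDiff Y.contMDiff (by simp)⟩

namespace TwoForm

variable (Ω : TwoForm E M)

lemma map_add_left (x : M) (u v w : TangentSpace 𝓘(ℝ, E) x) :
    Ω.toFun x (u + v) w = Ω.toFun x u w + Ω.toFun x v w := by
  rw [map_add]; rfl

lemma map_add_right (x : M) (u v w : TangentSpace 𝓘(ℝ, E) x) :
    Ω.toFun x u (v + w) = Ω.toFun x u v + Ω.toFun x u w := map_add _ _ _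

lemma map_smul_left (x : M) (c : ℝ) (u v : TangentSpace 𝓘(ℝ, E) x) :
    Ω.toFun x (c • u) v = c * Ω.toFun x u v := by
  rw [map_smul]; rfl

lemma map_smul_right (x : M) (c : ℝ) (u v : TangentSpace 𝓘(ℝ, E) x) :
    Ω.toFun x u (c • v) = c * Ω.toFun x u v := map_smul _ _ _

lemma map_neg_left (x : M) (u v : TangentSpace 𝓘(ℝ, E) x) :
    Ω.toFun x (-u) v = -Ω.toFun x u v := by
  rw [map_neg]; rfl

lemma map_neg_right (x : M) (u v : TangentSpace 𝓘(ℝ, E) x) :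
    Ω.toFun x u (-v) = -Ω.toFun x u v := map_neg _ _

lemma map_sub_left (x : M) (u v w : TangentSpace 𝓘(ℝ, E) x) :
    Ω.toFun x (u - v) w = Ω.toFun x u w - Ω.toFun x v w := by
  rw [map_sub]; rfl

lemma map_sub_right (x : M) (u v w : TangentSpace 𝓘(ℝ, E) x) :
    Ω.toFun x u (v - w) = Ω.toFun x u v - Ω.toFun x u w := map_sub _ _ _

lemma map_zero_left (x : M) (v : TangentSpace 𝓘(ℝ, E) x) : Ω.toFun x 0 v = 0 := by
  rw [map_zero]; rfl

lemma swap (x : M) (u v : TangentSpace 𝓘(ℝ, E) x) : Ω.toFun x u v = -Ω.toFun x v u := by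
  have h := Ω.alternating x (u + v)
  rw [map_add_left, map_add_right, map_add_right, Ω.alternating, Ω.alternating] at h
  linarith

lemma mem_charSpace {x : M} {v : TangentSpace 𝓘(ℝ, E) x} :
    v ∈ Ω.charSpace x ↔ ∀ w, Ω.toFun x v w = 0 :=
  ⟨fun h w => congrArg (fun T => T w) (show Ω.toFun x v = 0 from h),
    fun h => show Ω.toFun x v = 0 from ContinuousLinearMap.ext h⟩

lemma contMDiffAt_toFun {X Y : ∀ x : M, TangentSpace 𝓘(ℝ, E) x} {x : M}
    (hX : ContMDiffAt 𝓘(ℝ, E) 𝓘(ℝ, E).tangent ∞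
      (fun x => (⟨x, X x⟩ : TangentBundle 𝓘(ℝ, E) M)) x)
    (hY : ContMDiffAt 𝓘(ℝ, E) 𝓘(ℝ, E).tangent ∞
      (fun x => (⟨x, Y x⟩ : TangentBundle 𝓘(ℝ, E) M)) x) :
    ContMDiffAt 𝓘(ℝ, E) 𝓘(ℝ, ℝ) ∞ (fun x => Ω.toFun x (X x) (Y x)) x := by
  have := ContMDiffAt.clm_bundle_apply₂ (F₁ := E) (F₂ := E) (F₃ := ℝ)
    (E₁ := fun x : M => TangentSpace 𝓘(ℝ, E) x) (E₂ := fun x : M => TangentSpace 𝓘(ℝ, E) x)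
    (E₃ := Bundle.Trivial M ℝ) (b := id) (ψ := Ω.toFun) (v := X) (w := Y)
    (Ω.contMDiff x) hX hY
  exact (Bundle.contMDiffAt_totalSpace.1 this).2

lemma contMDiff_eval (X Y : VField E M) :
    ContMDiff 𝓘(ℝ, E) 𝓘(ℝ, ℝ) ∞ (Ω.eval X Y) :=
  fun x => Ω.contMDiffAt_toFun (X.contMDiff x) (Y.contMDiff x)

/-- The function `ω(X, Y)`, as an element of `C^∞(M)`. -/
noncomputable def evalFun (X Y : VField E M) : SmoothFun E M := ⟨Ω.eval X Y, Ω.contMDiff_eval X Y⟩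

lemma psi_add_left [CompleteSpace E] (X X' Y V : VField E M) (x : M) :
    Ω.psi (X + X') Y V x = Ω.psi X Y V x + Ω.psi X' Y V x := by
  simp only [psi, dirDeriv_add_left, bracket_add_left, map_add_right]
  ring

lemma psi_add_middle (X Y Y' V : VField E M) (x : M) :
    Ω.psi X (Y + Y') V x = Ω.psi X Y V x + Ω.psi X Y' V x := by
  have h : Ω.eval (Y + Y') V = fun x => Ω.eval Y V x + Ω.eval Y' V x :=
    funext fun x => Ω.map_add_left x _ _ _
  simp only [psi, h, dirDeriv_add (Ω.contMDiff_eval _ _) (Ω.contMDiff_eval _ _),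
    VField.add_apply, map_add_left]
  ring

lemma psi_add_right [CompleteSpace E] (X Y V V' : VField E M) (x : M) :
    Ω.psi X Y (V + V') x = Ω.psi X Y V x + Ω.psi X Y V' x := by
  have h : Ω.eval Y (V + V') = fun x => Ω.eval Y V x + Ω.eval Y V' x :=
    funext fun x => Ω.map_add_right x _ _ _
  simp only [psi, h, dirDeriv_add (Ω.contMDiff_eval _ _) (Ω.contMDiff_eval _ _),
    bracket_add_right, map_add_right]
  ring

lemma psi_fsmul_left [CompleteSpace E] (f : SmoothFun E M) (X Y V : VField E M) (x : M) :
    Ω.psi (fsmul f X) Y V x = f x * Ω.psi X Y V x + dirDeriv V f x * Ω.toFun x (Y x) (X x) := by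
  simp only [psi, dirDeriv_fsmul_left, bracket_fsmul_left, map_sub_right, map_smul_right]
  ring

lemma psi_fsmul_middle (f : SmoothFun E M) (X Y V : VField E M) (x : M) :
    Ω.psi X (fsmul f Y) V x = f x * Ω.psi X Y V x + dirDeriv X f x * Ω.toFun x (Y x) (V x) := by
  have h : Ω.eval (fsmul f Y) V = fun x => f x * Ω.eval Y V x :=
    funext fun x => Ω.map_smul_left x _ _ _
  simp only [psi, h, dirDeriv_mul f.contMDiff (Ω.contMDiff_eval _ _), fsmul_apply, map_smul_left]
  simp only [eval]
  ring

/-- `ψ` is `C^∞(M)`-linear in its last argument: the derivatives of the factor cancel. -/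
lemma psi_fsmul_right [CompleteSpace E] (f : SmoothFun E M) (X Y V : VField E M) (x : M) :
    Ω.psi X Y (fsmul f V) x = f x * Ω.psi X Y V x := by
  have h : Ω.eval Y (fsmul f V) = fun x => f x * Ω.eval Y V x :=
    funext fun x => Ω.map_smul_right x _ _ _
  simp only [psi, h, dirDeriv_mul f.contMDiff (Ω.contMDiff_eval _ _), bracket_fsmul_right,
    map_add_right, map_smul_right]
  simp only [eval]
  ring

lemma contMDiff_psi [CompleteSpace E] (X Y V : VField E M) : ContMDiff 𝓘(ℝ, E) 𝓘(ℝ, ℝ) ∞ (Ω.psi X Y V) :=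
  (contMDiff_dirDeriv X (Ω.contMDiff_eval Y V)).sub (Ω.contMDiff_eval Y (lie X V))

/-- The function `ψ(X, Y, V)`, as an element of `C^∞(M)`. -/
noncomputable def psiFun [CompleteSpace E] (X Y V : VField E M) : SmoothFun E M := ⟨Ω.psi X Y V, Ω.contMDiff_psi X Y V⟩

/-- `ψ(X, Y, V)` vanishes if `Y` takes its values in the characteristic spaces of `ω`. -/
lemma psi_eq_zero (X V : VField E M) {Y : VField E M} (hY : ∀ x, Y x ∈ Ω.charSpace x) (x : M) :
    Ω.psi X Y V x = 0 := by
  have h : Ω.eval Y V = fun _ => 0 := funext fun x => Ω.mem_charSpace.1 (hY x) _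
  rw [psi, h, dirDeriv_zero, Ω.mem_charSpace.1 (hY x), sub_zero]

end TwoForm

end Calculus

section LinearSystems

variable {E : Type*} [NormedAddCommGroup E] [NormedSpace ℝ E]
  {M : Type*} [TopologicalSpace M] [ChartedSpace E M]

/-! ### Linear systems with smooth coefficients -/

lemma contMDiffAt_det {κ : Type*} [Fintype κ] [DecidableEq κ] {A : M → Matrix κ κ ℝ} {x : M}
    (hA : ∀ i j, ContMDiffAt 𝓘(ℝ, E) 𝓘(ℝ, ℝ) ∞ (fun y => A y i j) x) :
    ContMDiffAt 𝓘(ℝ, E) 𝓘(ℝ, ℝ) ∞ (fun y => (A y).det) x := by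
  simp only [Matrix.det_apply']
  refine contMDiffAt_finsetSum fun σ _ => contMDiffAt_const.mul ?_
  exact contMDiffAt_finsetProd fun i _ => hA _ _

/-- Cramer's rule with smooth coefficients: the solution of a linear system whose matrix and
right-hand side depend smoothly on the point, and whose matrix is invertible at `x`, is smooth. -/
lemma contMDiffAt_of_mulVec {κ : Type*} [Fintype κ] [DecidableEq κ] {A : M → Matrix κ κ ℝ}
    {c : M → κ → ℝ} {x : M}
    (hA : ∀ i j, ContMDiffAt 𝓘(ℝ, E) 𝓘(ℝ, ℝ) ∞ (fun y => A y i j) x) (hdet : (A x).det ≠ 0)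
    (hc : ∀ i, ContMDiffAt 𝓘(ℝ, E) 𝓘(ℝ, ℝ) ∞ (fun y => (A y).mulVec (c y) i) x) (j : κ) :
    ContMDiffAt 𝓘(ℝ, E) 𝓘(ℝ, ℝ) ∞ (fun y => c y j) x := by
  have hd := contMDiffAt_det hA
  have hadj : ∀ i, ContMDiffAt 𝓘(ℝ, E) 𝓘(ℝ, ℝ) ∞ (fun y => (A y).adjugate j i) x := fun i => by
    simp only [Matrix.adjugate_apply]
    refine contMDiffAt_det fun k l => ?_
    by_cases h : k = i
    · simpa only [h, Matrix.updateRow_self] using contMDiffAt_const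
    · simpa only [Matrix.updateRow_ne h] using hA k l
  have hs : ContMDiffAt 𝓘(ℝ, E) 𝓘(ℝ, ℝ) ∞
      (fun y => (A y).det⁻¹ * ∑ i, (A y).adjugate j i * (A y).mulVec (c y) i) x :=
    (hd.inv₀ hdet).mul (contMDiffAt_finsetSum fun i _ => (hadj i).mul (hc i))
  refine hs.congr_of_eventuallyEq ?_
  filter_upwards [hd.continuousAt.eventually_ne hdet] with y hy
  have h : (A y).adjugate.mulVec ((A y).mulVec (c y)) j = (A y).det * c y j := by
    rw [Matrix.mulVec_mulVec, Matrix.adjugate_mul, Matrix.smul_mulVec, Matrix.one_mulVec]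
    rfl
  change c y j = (A y).det⁻¹ * (A y).adjugate.mulVec ((A y).mulVec (c y)) j
  rw [h, inv_mul_cancel_left₀ hy]

end LinearSystems

section Locality

variable {E : Type*} [NormedAddCommGroup E] [NormedSpace ℝ E] [FiniteDimensional ℝ E]
  {M : Type*} [TopologicalSpace M] [ChartedSpace E M] [IsManifold 𝓘(ℝ, E) ∞ M]

/-! ### Smooth fields and tensorial functionals -/

/-- A field of tangent vectors `V` is smooth as soon as the functions `ω_i(V, W_i)` are smooth, for
a family of `2`-forms `ω_i` and fields `W_i` such that the linear forms `ω_i(·, W_i)` separate the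
vectors of every tangent space: near a given point the components of `V` in a frame solve an
invertible linear system. -/
lemma contMDiff_of_separating {V : ∀ x : M, TangentSpace 𝓘(ℝ, E) x} {ι : Type*}
    (Ω : ι → TwoForm E M) (W : ι → VField E M)
    (hsep : ∀ (x : M) (v : TangentSpace 𝓘(ℝ, E) x),
      (∀ i, (Ω i).toFun x v (W i x) = 0) → v = 0)
    (hV : ∀ i, ContMDiff 𝓘(ℝ, E) 𝓘(ℝ, ℝ) ∞ (fun x => (Ω i).toFun x (V x) (W i x))) :
    ContMDiff 𝓘(ℝ, E) 𝓘(ℝ, E).tangent ∞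
      (fun x => (⟨x, V x⟩ : TangentBundle 𝓘(ℝ, E) M)) := by
  classical
  intro x
  have hfd : FiniteDimensional ℝ (TangentSpace 𝓘(ℝ, E) x) :=
    inferInstanceAs (FiniteDimensional ℝ E)
  let η : ι → Module.Dual ℝ (TangentSpace 𝓘(ℝ, E) x) := fun i =>
    { toFun := fun v => (Ω i).toFun x v (W i x)
      map_add' := fun v w => (Ω i).map_add_left x v w _
      map_smul' := fun c v => (Ω i).map_smul_left x c v _ }
  have hspan : Submodule.span ℝ (Set.range η) = ⊤ := by
    have h0 : (Submodule.span ℝ (Set.range η)).dualCoannihilator = ⊥ := by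
      rw [eq_bot_iff]
      intro v hv
      rw [Submodule.mem_dualCoannihilator] at hv
      exact hsep x v fun i => hv _ (Submodule.subset_span ⟨i, rfl⟩)
    rw [← Subspace.dualCoannihilator_dualAnnihilator_eq (W := Submodule.span ℝ (Set.range η)), h0,
      Submodule.dualAnnihilator_bot]
  -- Some of the forms `η i` are a basis of the dual; frames of `TM` get the same index type, so
  -- that the linear system for the components of `V` is square.
  obtain ⟨κ, a, -, ha, hli⟩ := exists_linearIndependent' ℝ η
  let B : Module.Basis κ ℝ (Module.Dual ℝ (TangentSpace 𝓘(ℝ, E) x)) :=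
    Module.Basis.mk hli (by rw [ha, hspan])
  have : Fintype κ := FiniteDimensional.fintypeBasisIndex B
  have hcard : Module.finrank ℝ E = Fintype.card κ := by
    rw [← Module.finrank_eq_card_basis B, Subspace.dual_finrank_eq]
    rfl
  let b : Module.Basis κ ℝ E := (Module.finBasis ℝ E).reindex
    (Fintype.equivOfCardEq (by rw [Fintype.card_fin, hcard]))
  let e := trivializationAt E (fun x : M => TangentSpace 𝓘(ℝ, E) x) x
  have hx : x ∈ e.baseSet := FiberBundle.mem_baseSet_trivializationAt' x
  let s := e.localFrame b
  have hs : ∀ j, ContMDiffAt 𝓘(ℝ, E) 𝓘(ℝ, E).tangent ∞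
      (fun y => (⟨y, s j y⟩ : TangentBundle 𝓘(ℝ, E) M)) x := fun j =>
    contMDiffAt_localFrame_of_mem ∞ e b j hx
  let c : M → κ → ℝ := fun y j => e.localFrameCoeff 𝓘(ℝ, E) b j y (V y)
  let A : M → Matrix κ κ ℝ := fun y => .of fun i j => (Ω (a i)).toFun y (s j y) (W (a i) y)
  have hsum : ∀ (y : M) (d : κ → ℝ) (i : κ),
      (A y).mulVec d i = (Ω (a i)).toFun y (∑ j, d j • s j y) (W (a i) y) := fun y d i => by
    rw [map_sum, sum_apply]
    refine Finset.sum_congr rfl fun j _ => ?_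
    rw [TwoForm.map_smul_left, mul_comm]
    rfl
  refine (contMDiffAt_iff_localFrameCoeff (e := e) b hx).2 ?_
  refine contMDiffAt_of_mulVec (A := A) (c := c)
    (fun i j => (Ω (a i)).contMDiffAt_toFun (hs j) ((W (a i)).contMDiff x)) ?_ fun i => ?_
  · intro hdet
    obtain ⟨d, hd, hd0⟩ := Matrix.exists_mulVec_eq_zero_iff.2 hdet
    have hv0 : ∑ j, d j • s j x = 0 := by
      refine hsep x _ fun i => ?_
      have hi : ∀ k, B k (∑ j, d j • s j x) = 0 := fun k => by
        have h1 := congrFun hd0 k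
        rw [hsum] at h1
        rw [Module.Basis.mk_apply]
        exact h1
      change η i _ = 0
      rw [← B.sum_repr (η i), LinearMap.sum_apply]
      exact Finset.sum_eq_zero fun k _ => by rw [LinearMap.smul_apply, hi, smul_zero]
    have hlin : LinearIndependent ℝ (fun j => s j x) :=
      (e.isLocalFrameOn_localFrame_baseSet 𝓘(ℝ, E) 1 b).linearIndependent hx
    exact hd (funext (Fintype.linearIndependent_iff.1 hlin d hv0))
  · refine (hV (a i) x).congr_of_eventuallyEq ?_
    filter_upwards [e.open_baseSet.mem_nhds hx] with y hy
    rw [hsum, ← e.eq_sum_localFrameCoeff_smul (I := 𝓘(ℝ, E)) (b := b) hy (s := V)]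

variable [T2Space M]

lemma exists_cutoff {U : Set M} (hU : IsOpen U) {x : M} (hx : x ∈ U) :
    ∃ χ : SmoothFun E M, tsupport χ ⊆ U ∧ χ x = 1 := by
  obtain ⟨f, -, hf⟩ := (SmoothBumpFunction.nhds_basis_tsupport (I := 𝓘(ℝ, E)) x).mem_iff.1
    (hU.mem_nhds hx)
  exact ⟨⟨f, f.contMDiff⟩, hf, f.eq_one⟩

/-- The global vector field `χ s` obtained from a local vector field `s` and a cutoff `χ`. -/
noncomputable def cutoffField {U : Set M} (hU : IsOpen U) (χ : SmoothFun E M) (hχ : tsupport χ ⊆ U)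
    (s : ∀ x : M, TangentSpace 𝓘(ℝ, E) x)
    (hs : ContMDiffOn 𝓘(ℝ, E) 𝓘(ℝ, E).tangent ∞
      (fun x => (⟨x, s x⟩ : TangentBundle 𝓘(ℝ, E) M)) U) : VField E M :=
  ⟨fun x => χ x • s x,
    ContMDiffOn.smul_section_of_tsupport χ.contMDiff.contMDiffOn hU hχ hs⟩

lemma exists_section_apply_eq {r : ℕ} (D : Distribution E M r) {x : M}
    {v : TangentSpace 𝓘(ℝ, E) x} (hv : v ∈ D.fiber x) :
    ∃ X : VField E M, IsSectionOf D.fiber X ∧ X x = v := by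
  obtain ⟨U, hU, hx, s, hs, hspan⟩ := D.exists_local_frame x
  rw [← (hspan x hx).2, Submodule.mem_span_range_iff_exists_fun] at hv
  obtain ⟨c, rfl⟩ := hv
  obtain ⟨χ, hχ, hχx⟩ := exists_cutoff (E := E) hU hx
  refine ⟨cutoffField hU χ hχ (fun y => ∑ i, c i • s i y)
    (.sum_section fun i _ => (hs i).const_smul_section), fun y => ?_, ?_⟩
  · change χ y • ∑ i, c i • s i y ∈ _
    by_cases hy : y ∈ U
    · refine Submodule.smul_mem _ _ (Submodule.sum_mem _ fun i _ => Submodule.smul_mem _ _ ?_)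
      rw [← (hspan y hy).2]
      exact Submodule.subset_span ⟨i, rfl⟩
    · rw [image_eq_zero_of_notMem_tsupport fun h => hy (hχ h), zero_smul]
      exact Submodule.zero_mem _
  · change χ x • ∑ i, c i • s i x = _
    rw [hχx, one_smul]

lemma exists_field_apply_eq (x : M) (v : TangentSpace 𝓘(ℝ, E) x) :
    ∃ X : VField E M, X x = v := by
  obtain ⟨s, hs, h⟩ := FiberBundle.exists_contMDiffOn_extend (k := ∞) 𝓘(ℝ, E) E v
  obtain ⟨χ, hχ, hχx⟩ := exists_cutoff (E := E) isOpen_interior (mem_interior_iff_mem_nhds.2 hs)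
  refine ⟨cutoffField isOpen_interior χ hχ _ (h.mono interior_subset), ?_⟩
  change χ x • FiberBundle.extend E v x = v
  rw [hχx, one_smul, FiberBundle.extend_apply_self]

/-- A functional on vector fields which is linear over the functions at `x` vanishes on the fields
which vanish at `x`. Multiplying by the square of a cutoff function turns the expansion of the
field in a local frame into one with global coefficients and global fields. -/
lemma apply_eq_zero_of_tensorial {x : M} (F : VField E M →+ ℝ)
    (hF : ∀ (f : SmoothFun E M) (W : VField E M), F (fsmul f W) = f x * F W)
    {W : VField E M} (hW : W x = 0) : F W = 0 := by
  let e := trivializationAt E (fun x : M => TangentSpace 𝓘(ℝ, E) x) x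
  have hx : x ∈ e.baseSet := FiberBundle.mem_baseSet_trivializationAt' x
  let b := Module.finBasis ℝ E
  obtain ⟨χ, hχ, hχx⟩ := exists_cutoff (E := E) e.open_baseSet hx
  have hs := fun i => e.contMDiffOn_localFrame_baseSet (I := 𝓘(ℝ, E)) ∞ b i
  let S : Fin (Module.finrank ℝ E) → VField E M := fun i => cutoffField e.open_baseSet χ hχ (e.localFrame b i) (hs i)
  have hc : ∀ i, ContMDiffOn 𝓘(ℝ, E) 𝓘(ℝ, ℝ) ∞
      (fun y => e.localFrameCoeff 𝓘(ℝ, E) b i y (W y)) e.baseSet := fun i =>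
    contMDiffOn_baseSet_localFrameCoeff (e := e) b W.contMDiff.contMDiffOn i
  have hC : ∀ i, ContMDiff 𝓘(ℝ, E) 𝓘(ℝ, ℝ) ∞
      (fun y => χ y * e.localFrameCoeff 𝓘(ℝ, E) b i y (W y)) := fun i => by
    refine contMDiff_of_tsupport fun y hy => ?_
    have hy' : y ∈ e.baseSet := hχ (tsupport_mul_subset_left hy)
    exact (χ.contMDiff y).mul ((hc i).contMDiffAt (e.open_baseSet.mem_nhds hy'))
  let C : Fin (Module.finrank ℝ E) → SmoothFun E M := fun i => ⟨_, hC i⟩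
  have key : fsmul (χ * χ) W = ∑ i, fsmul (C i) (S i) := by
    ext y
    have h1 : (∑ i, fsmul (C i) (S i) : VField E M) y
        = ∑ i, (χ y * e.localFrameCoeff 𝓘(ℝ, E) b i y (W y)) • (χ y • e.localFrame b i y) := by
      rw [← ContMDiffSection.coeAddHom_apply, map_sum, Finset.sum_apply]
      rfl
    rw [h1]
    change (χ y * χ y) • W y = _
    by_cases hy : y ∈ e.baseSet
    · conv_lhs => rw [e.eq_sum_localFrameCoeff_smul (I := 𝓘(ℝ, E)) (b := b) hy (s := W)]
      rw [Finset.smul_sum]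
      refine Finset.sum_congr rfl fun i _ => ?_
      rw [smul_smul, smul_smul]
      congr 1
      ring
    · have : χ y = 0 := image_eq_zero_of_notMem_tsupport fun h => hy (hχ h)
      simp [this]
  have h2 : F (fsmul (χ * χ) W) = F W := by
    rw [hF]
    change (χ x * χ x) * F W = F W
    rw [hχx]; ring
  rw [← h2, key, map_sum]
  refine Finset.sum_eq_zero fun i _ => ?_
  rw [hF]
  change (χ x * e.localFrameCoeff 𝓘(ℝ, E) b i x (W x)) * _ = 0
  rw [hW, map_zero]
  ring

/-- A functional on vector fields which is linear over the functions at `x` is given by a linear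
form on the tangent space at `x`. -/
lemma exists_linearMap_of_tensorial (x : M) (F : VField E M →+ ℝ)
    (hF : ∀ (f : SmoothFun E M) (W : VField E M), F (fsmul f W) = f x * F W) :
    ∃ φ : TangentSpace 𝓘(ℝ, E) x →ₗ[ℝ] ℝ, ∀ W, F W = φ (W x) := by
  choose ext hext using exists_field_apply_eq (E := E) (M := M) x
  have key : ∀ W W' : VField E M, W x = W' x → F W = F W' := fun W W' h => by
    rw [← sub_eq_zero, ← map_sub]
    refine apply_eq_zero_of_tensorial F hF ?_
    rw [VField.sub_apply, h, sub_self]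
  refine ⟨{ toFun := fun v => F (ext v), map_add' := fun v w => ?_, map_smul' := fun c v => ?_ },
    fun W => key _ _ (hext _).symm⟩
  · rw [← map_add]
    refine key _ _ ?_
    rw [VField.add_apply, hext, hext, hext]
  · have := hF ⟨fun _ => c, contMDiff_const⟩ (ext v)
    refine Eq.trans (key _ _ ?_) this
    change ext (c • v) x = c • ext v x
    rw [hext, hext]

end Locality

section LinearAlgebra

/-! ### Linear algebra of several alternating forms -/

variable {V : Type*} [AddCommGroup V] [Module ℝ V] [FiniteDimensional ℝ V] {n k : ℕ}
  {B : Fin k → V →ₗ[ℝ] V →ₗ[ℝ] ℝ} {L Q : Submodule ℝ V}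

/-- If no nonzero vector of `L` is orthogonal to `Q` for all the forms, then, by the dimensions,
`X ↦ (B_γ(X, ·)|_Q)_γ` is an isomorphism of `L` with `(Q^*)^k`. -/
lemma exists_linearEquiv_pi_dual (hL : Module.finrank ℝ L = n * k) (hQ : Module.finrank ℝ Q = n)
    (hB : ∀ v ∈ L, (∀ γ, ∀ q ∈ Q, B γ v q = 0) → v = 0) :
    ∃ e : L ≃ₗ[ℝ] (Fin k → Module.Dual ℝ Q), ∀ (X : L) (γ : Fin k) (q : Q),
      e X γ q = B γ X q := by
  let f : L →ₗ[ℝ] (Fin k → Module.Dual ℝ Q) :=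
    LinearMap.pi fun γ => Q.dualRestrict ∘ₗ B γ ∘ₗ L.subtype
  have hinj : Function.Injective f := by
    rw [← LinearMap.ker_eq_bot, LinearMap.ker_eq_bot']
    intro X hX
    exact Subtype.ext (hB X X.2 fun γ q hq => LinearMap.congr_fun (congrFun hX γ) ⟨q, hq⟩)
  have hdim : Module.finrank ℝ L = Module.finrank ℝ (Fin k → Module.Dual ℝ Q) := by
    rw [Module.finrank_pi_fintype, hL]
    simp [Subspace.dual_finrank_eq, hQ, mul_comm]
  exact ⟨LinearEquiv.ofBijective f
    ⟨hinj, (LinearMap.injective_iff_surjective_of_finrank_eq_finrank hdim).1 hinj⟩,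
    fun _ _ _ => rfl⟩

lemma exists_mem_forall_apply_eq (hL : Module.finrank ℝ L = n * k) (hQ : Module.finrank ℝ Q = n)
    (hB : ∀ v ∈ L, (∀ γ, ∀ q ∈ Q, B γ v q = 0) → v = 0) (θ : Fin k → V →ₗ[ℝ] ℝ) :
    ∃ X ∈ L, ∀ γ, ∀ q ∈ Q, B γ X q = θ γ q := by
  obtain ⟨e, he⟩ := exists_linearEquiv_pi_dual hL hQ hB
  refine ⟨e.symm fun γ => Q.dualRestrict (θ γ), (e.symm _).2, fun γ q hq => ?_⟩
  rw [← he _ γ ⟨q, hq⟩, LinearEquiv.apply_symm_apply]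
  rfl

/-- The map `Z ↦ B_α(·, Z)` from `Q` to the dual of the `α`-th summand of `L ≅ (Q^*)^k` is
surjective: it is the transpose of the isomorphism of this summand with `Q^*`. -/
lemma exists_mem_apply_eq_of_summand (hL : Module.finrank ℝ L = n * k)
    (hQ : Module.finrank ℝ Q = n)
    (hB : ∀ v ∈ L, (∀ γ, ∀ q ∈ Q, B γ v q = 0) → v = 0) (α : Fin k) (η : V →ₗ[ℝ] ℝ) :
    ∃ Z ∈ Q, ∀ X ∈ L, (∀ γ, γ ≠ α → ∀ q ∈ Q, B γ X q = 0) → B α X Z = η X := by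
  obtain ⟨e, he⟩ := exists_linearEquiv_pi_dual hL hQ hB
  let φ : Module.Dual ℝ (Module.Dual ℝ Q) :=
    η ∘ₗ L.subtype ∘ₗ e.symm.toLinearMap ∘ₗ LinearMap.single ℝ (fun _ => Module.Dual ℝ Q) α
  refine ⟨(Module.evalEquiv ℝ Q).symm φ, ((Module.evalEquiv ℝ Q).symm φ).2, fun X hX h => ?_⟩
  have hsingle : e ⟨X, hX⟩ = Pi.single α (e ⟨X, hX⟩ α) := by
    funext γ
    by_cases hγ : γ = α
    · subst hγ
      rw [Pi.single_eq_same]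
    · rw [Pi.single_eq_of_ne hγ]
      exact LinearMap.ext fun q => (he _ _ _).trans (h γ hγ q q.2)
  rw [← he ⟨X, hX⟩ α, Module.apply_evalEquiv_symm_apply]
  change η (e.symm (Pi.single α (e ⟨X, hX⟩ α))) = η X
  rw [← hsingle, LinearEquiv.symm_apply_apply]

end LinearAlgebra

section Splitting

variable {E : Type*} [NormedAddCommGroup E] [NormedSpace ℝ E]
  {M : Type*} [TopologicalSpace M] [ChartedSpace E M] [IsManifold 𝓘(ℝ, E) ∞ M]

/-! ### The splitting of the tangent bundle -/

lemma IsSectionOf.add {D : ∀ x : M, Submodule ℝ (TangentSpace 𝓘(ℝ, E) x)} {X Y : VField E M}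
    (hX : IsSectionOf D X) (hY : IsSectionOf D Y) : IsSectionOf D (X + Y) :=
  fun x => (D x).add_mem (hX x) (hY x)

lemma IsSectionOf.sub {D : ∀ x : M, Submodule ℝ (TangentSpace 𝓘(ℝ, E) x)} {X Y : VField E M}
    (hX : IsSectionOf D X) (hY : IsSectionOf D Y) : IsSectionOf D (X - Y) :=
  fun x => (D x).sub_mem (hX x) (hY x)

lemma IsSectionOf.fsmul {D : ∀ x : M, Submodule ℝ (TangentSpace 𝓘(ℝ, E) x)} {X : VField E M}
    (f : SmoothFun E M) (hX : IsSectionOf D X) : IsSectionOf D (fsmul f X) :=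
  fun x => (D x).smul_mem _ (hX x)

lemma isSectionOf_zero (D : ∀ x : M, Submodule ℝ (TangentSpace 𝓘(ℝ, E) x)) :
    IsSectionOf D (0 : VField E M) :=
  fun x => (D x).zero_mem

/-- A `C^∞(M)`-linear functional on the smooth vector fields, with values in `C^∞(M)`. -/
structure IsTensorial (θ : VField E M → SmoothFun E M) : Prop where
  map_add : ∀ (W W' : VField E M) (x : M), θ (W + W') x = θ W x + θ W' x
  map_fsmul : ∀ (f : SmoothFun E M) (W : VField E M) (x : M), θ (fsmul f W) x = f x * θ W x

lemma isTensorial_zero : IsTensorial (fun _ : VField E M => (0 : SmoothFun E M)) where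
  map_add _ _ _ := (add_zero (0 : ℝ)).symm
  map_fsmul _ _ _ := (mul_zero _).symm

lemma TwoForm.isTensorial_evalFun (Ω : TwoForm E M) (X : VField E M) :
    IsTensorial (Ω.evalFun X) where
  map_add _ _ x := Ω.map_add_right x _ _ _
  map_fsmul _ _ x := Ω.map_smul_right x _ _ _

lemma TwoForm.isTensorial_psiFun [CompleteSpace E] (Ω : TwoForm E M) (X Y : VField E M) :
    IsTensorial (Ω.psiFun X Y) where
  map_add _ _ x := Ω.psi_add_right _ _ _ _ x
  map_fsmul f _ x := Ω.psi_fsmul_right f _ _ _ x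

lemma IsTensorial.exists_linearMap [FiniteDimensional ℝ E] [T2Space M]
    {θ : VField E M → SmoothFun E M} (hθ : IsTensorial θ) (x : M) :
    ∃ φ : TangentSpace 𝓘(ℝ, E) x →ₗ[ℝ] ℝ, ∀ W, θ W x = φ (W x) :=
  exists_linearMap_of_tensorial x
    (AddMonoidHom.mk' (fun W => θ W x) fun W W' => hθ.map_add W W' x)
    (fun f W => hθ.map_fsmul f W x)

lemma Distribution.finrank_fiber {r : ℕ} (D : Distribution E M r) (x : M) :
    Module.finrank ℝ (D.fiber x) = r := by
  obtain ⟨U, -, hx, s, -, hs⟩ := D.exists_local_frame x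
  rw [← (hs x hx).2, finrank_span_eq_card (hs x hx).1, Fintype.card_fin]

/-- The bilinear form `ω_x`, as a linear map without topology. -/
noncomputable def TwoForm.toLinearMap (Ω : TwoForm E M) (x : M) :
    TangentSpace 𝓘(ℝ, E) x →ₗ[ℝ] TangentSpace 𝓘(ℝ, E) x →ₗ[ℝ] ℝ where
  toFun v := (Ω.toFun x v).toLinearMap
  map_add' v w := LinearMap.ext fun u => Ω.map_add_left x v w u
  map_smul' c v := LinearMap.ext fun u => Ω.map_smul_left x c v u

variable {n k : ℕ}

namespace Structure

lemma mem_leaf (S : Structure E M n k) {α : Fin k} {x : M} {v : TangentSpace 𝓘(ℝ, E) x} :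
    v ∈ S.leaf α x ↔ v ∈ S.L.fiber x ∧ ∀ β, β ≠ α → ∀ w, (S.form β).toFun x v w = 0 := by
  simp only [leaf, Submodule.mem_inf, Submodule.mem_iInf, TwoForm.mem_charSpace]

/-- The distribution `Q` is a complement of `L` on which all the forms `ω_α` vanish. -/
structure IsIsotropicComplement (S : Structure E M n k) (Q : Distribution E M n) : Prop where
  isCompl : ∀ x, IsCompl (S.L.fiber x) (Q.fiber x)
  vanishesOn : ∀ α, (S.form α).VanishesOn Q.fiber

namespace IsIsotropicComplement

variable {S : Structure E M n k} {Q : Distribution E M n} (H : S.IsIsotropicComplement Q)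

include H

lemma exists_add_eq (x : M) (v : TangentSpace 𝓘(ℝ, E) x) :
    ∃ l ∈ S.L.fiber x, ∃ q ∈ Q.fiber x, l + q = v :=
  Submodule.mem_sup.1 ((H.isCompl x).sup_eq_top ▸ Submodule.mem_top)

lemma eq_zero_of_mem_of_mem {x : M} {v : TangentSpace 𝓘(ℝ, E) x} (hL : v ∈ S.L.fiber x)
    (hQ : v ∈ Q.fiber x) : v = 0 :=
  (Submodule.disjoint_def.1 (H.isCompl x).disjoint) v hL hQ

lemma eq_zero {x : M} {v : TangentSpace 𝓘(ℝ, E) x}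
    (hL : ∀ β, ∀ l ∈ S.L.fiber x, (S.form β).toFun x v l = 0)
    (hQ : ∀ β, ∀ q ∈ Q.fiber x, (S.form β).toFun x v q = 0) : v = 0 := by
  rw [← Submodule.mem_bot ℝ, ← S.iInf_charSpace x, Submodule.mem_iInf]
  intro β
  refine (S.form β).mem_charSpace.2 fun w => ?_
  obtain ⟨l, hl, q, hq, rfl⟩ := H.exists_add_eq x w
  rw [TwoForm.map_add_right, hL β l hl, hQ β q hq, add_zero]

lemma eq_zero_of_mem_L {x : M} {v : TangentSpace 𝓘(ℝ, E) x} (hv : v ∈ S.L.fiber x)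
    (hQ : ∀ β, ∀ q ∈ Q.fiber x, (S.form β).toFun x v q = 0) : v = 0 :=
  H.eq_zero (fun β l hl => S.vanishesOn β x v hv l hl) hQ

lemma eq_zero_of_mem_Q {x : M} {v : TangentSpace 𝓘(ℝ, E) x} (hv : v ∈ Q.fiber x)
    (hL : ∀ β, ∀ l ∈ S.L.fiber x, (S.form β).toFun x v l = 0) : v = 0 :=
  H.eq_zero hL (fun β q hq => H.vanishesOn β x v hv q hq)

lemma mem_leaf_of {α : Fin k} {x : M} {v : TangentSpace 𝓘(ℝ, E) x} (hv : v ∈ S.L.fiber x)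
    (hQ : ∀ β, β ≠ α → ∀ q ∈ Q.fiber x, (S.form β).toFun x v q = 0) : v ∈ S.leaf α x := by
  refine S.mem_leaf.2 ⟨hv, fun β hβ w => ?_⟩
  obtain ⟨l, hl, q, hq, rfl⟩ := H.exists_add_eq x w
  rw [TwoForm.map_add_right, S.vanishesOn β x v hv l hl, hQ β hβ q hq, add_zero]

variable [FiniteDimensional ℝ E] [T2Space M]

lemma eq_of_forall_sections {U U' : VField E M}
    (hQ : ∀ β Y, IsSectionOf Q.fiber Y → ∀ x, (S.form β).eval U Y x = (S.form β).eval U' Y x)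
    (hL : ∀ β X, IsSectionOf S.L.fiber X →
      ∀ x, (S.form β).eval U X x = (S.form β).eval U' X x) : U = U' := by
  ext x
  rw [← sub_eq_zero]
  refine H.eq_zero (fun β l hl => ?_) (fun β q hq => ?_)
  · obtain ⟨X, hX, rfl⟩ := exists_section_apply_eq _ hl
    rw [TwoForm.map_sub_left, sub_eq_zero]
    exact hL β X hX x
  · obtain ⟨Y, hY, rfl⟩ := exists_section_apply_eq _ hq
    rw [TwoForm.map_sub_left, sub_eq_zero]
    exact hQ β Y hY x

/-- Smoothness can be tested by pairing with the sections of `L` and of `Q`. -/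
lemma contMDiff_of_pairings {V : ∀ x : M, TangentSpace 𝓘(ℝ, E) x}
    (hL : ∀ β (X : VField E M), IsSectionOf S.L.fiber X →
      ContMDiff 𝓘(ℝ, E) 𝓘(ℝ, ℝ) ∞ (fun x => (S.form β).toFun x (V x) (X x)))
    (hQ : ∀ β (Y : VField E M), IsSectionOf Q.fiber Y →
      ContMDiff 𝓘(ℝ, E) 𝓘(ℝ, ℝ) ∞ (fun x => (S.form β).toFun x (V x) (Y x))) :
    ContMDiff 𝓘(ℝ, E) 𝓘(ℝ, E).tangent ∞
      (fun x => (⟨x, V x⟩ : TangentBundle 𝓘(ℝ, E) M)) := by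
  refine contMDiff_of_separating
    (ι := Fin k × {W : VField E M // IsSectionOf S.L.fiber W ∨ IsSectionOf Q.fiber W})
    (fun i => S.form i.1) (fun i => i.2.1) (fun x v hv => ?_) (fun ⟨β, W, hW⟩ => ?_)
  · refine H.eq_zero (fun β l hl => ?_) (fun β q hq => ?_)
    · obtain ⟨X, hX, rfl⟩ := exists_section_apply_eq _ hl
      exact hv (β, ⟨X, .inl hX⟩)
    · obtain ⟨Y, hY, rfl⟩ := exists_section_apply_eq _ hq
      exact hv (β, ⟨Y, .inr hY⟩)
  · exact hW.elim (hL β W) (hQ β W)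

/-- The projections onto `L` and `Q` are smooth: pairing the `L`-component of `W` with sections
of `Q` gives the same functions as pairing `W` with them. -/
lemma exists_decomposition (W : VField E M) :
    ∃ X Y : VField E M, IsSectionOf S.L.fiber X ∧ IsSectionOf Q.fiber Y ∧ X + Y = W := by
  choose l hl q hq hlq using fun x => H.exists_add_eq x (W x)
  have hsmooth := H.contMDiff_of_pairings (V := l)
    (fun β X hX => contMDiff_const.congr fun x => S.vanishesOn β x _ (hl x) _ (hX x))
    (fun β Y hY => ((S.form β).contMDiff_eval W Y).congr fun x => by
      rw [TwoForm.eval, ← hlq, TwoForm.map_add_left, H.vanishesOn β x _ (hq x) _ (hY x),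
        add_zero])
  refine ⟨⟨l, hsmooth⟩, W - ⟨l, hsmooth⟩, hl, fun x => ?_, add_sub_cancel _ _⟩
  change W x - l x ∈ Q.fiber x
  rw [← hlq, add_sub_cancel_left]
  exact hq x

/-- The component in `L` of a vector field. -/
noncomputable def partL (W : VField E M) : VField E M := (H.exists_decomposition W).choose

/-- The component in `Q` of a vector field. -/
noncomputable def partQ (W : VField E M) : VField E M :=
  (H.exists_decomposition W).choose_spec.choose

lemma partL_mem (W : VField E M) : IsSectionOf S.L.fiber (H.partL W) :=
  (H.exists_decomposition W).choose_spec.choose_spec.1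

lemma partQ_mem (W : VField E M) : IsSectionOf Q.fiber (H.partQ W) :=
  (H.exists_decomposition W).choose_spec.choose_spec.2.1

lemma partL_add_partQ (W : VField E M) : H.partL W + H.partQ W = W :=
  (H.exists_decomposition W).choose_spec.choose_spec.2.2

lemma parts_eq {W X Y : VField E M} (hX : IsSectionOf S.L.fiber X) (hY : IsSectionOf Q.fiber Y)
    (h : X + Y = W) : H.partL W = X ∧ H.partQ W = Y := by
  have h1 : H.partL W - X = Y - H.partQ W := by
    rw [sub_eq_sub_iff_add_eq_add, H.partL_add_partQ, add_comm, h]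
  have h2 : H.partL W - X = 0 := ContMDiffSection.ext fun x =>
    H.eq_zero_of_mem_of_mem ((H.partL_mem W).sub hX x) (h1 ▸ hY.sub (H.partQ_mem W) x)
  exact ⟨sub_eq_zero.1 h2, (sub_eq_zero.1 (h1 ▸ h2)).symm⟩

lemma parts_add (W W' : VField E M) :
    H.partL (W + W') = H.partL W + H.partL W' ∧ H.partQ (W + W') = H.partQ W + H.partQ W' :=
  H.parts_eq ((H.partL_mem W).add (H.partL_mem W')) ((H.partQ_mem W).add (H.partQ_mem W'))
    (by rw [add_add_add_comm, H.partL_add_partQ, H.partL_add_partQ])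

lemma parts_fsmul (f : SmoothFun E M) (W : VField E M) :
    H.partL (KSymplectic.fsmul f W) = KSymplectic.fsmul f (H.partL W) ∧
      H.partQ (KSymplectic.fsmul f W) = KSymplectic.fsmul f (H.partQ W) :=
  H.parts_eq ((H.partL_mem W).fsmul f) ((H.partQ_mem W).fsmul f) <|
    ContMDiffSection.ext fun x => by
      rw [VField.add_apply, fsmul_apply, fsmul_apply, fsmul_apply, ← smul_add,
        ← VField.add_apply, H.partL_add_partQ]

lemma parts_of_mem_L {X : VField E M} (hX : IsSectionOf S.L.fiber X) :
    H.partL X = X ∧ H.partQ X = 0 :=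
  H.parts_eq hX (isSectionOf_zero _) (add_zero X)

lemma parts_of_mem_Q {Y : VField E M} (hY : IsSectionOf Q.fiber Y) :
    H.partL Y = 0 ∧ H.partQ Y = Y :=
  H.parts_eq (isSectionOf_zero _) hY (zero_add Y)

/-! ### Fields with prescribed pairings -/

lemma exists_section_L {θ : Fin k → VField E M → SmoothFun E M} (hθ : ∀ β, IsTensorial (θ β)) :
    ∃ X : VField E M, IsSectionOf S.L.fiber X ∧
      ∀ β Y, IsSectionOf Q.fiber Y → ∀ x, (S.form β).eval X Y x = θ β Y x := by
  have hx : ∀ x : M, ∃ v ∈ S.L.fiber x, ∀ β (Y : VField E M), IsSectionOf Q.fiber Y →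
      (S.form β).toFun x v (Y x) = θ β Y x := fun x => by
    have : FiniteDimensional ℝ (TangentSpace 𝓘(ℝ, E) x) :=
      inferInstanceAs (FiniteDimensional ℝ E)
    choose φ hφ using fun β => (hθ β).exists_linearMap x
    obtain ⟨v, hv, h⟩ := exists_mem_forall_apply_eq
      (B := fun β => (S.form β).toLinearMap x) (S.L.finrank_fiber x) (Q.finrank_fiber x)
      (fun v hv hv0 => H.eq_zero_of_mem_L hv hv0) φ
    exact ⟨v, hv, fun β Y hY => (h β _ (hY x)).trans (hφ β Y).symm⟩
  choose l hl hθl using hx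
  exact ⟨⟨l, H.contMDiff_of_pairings
    (fun β X hX => contMDiff_const.congr fun x => S.vanishesOn β x _ (hl x) _ (hX x))
    (fun β Y hY => (θ β Y).contMDiff.congr fun x => hθl x β Y hY)⟩, hl,
    fun β Y hY x => hθl x β Y hY⟩

/-- The section of `L_α` whose pairing with `Q` through `ω_α` is the given functional. -/
lemma exists_section_leaf (α : Fin k) {θ : VField E M → SmoothFun E M} (hθ : IsTensorial θ) :
    ∃ X : VField E M, IsSectionOf (S.leaf α) X ∧
      ∀ Y, IsSectionOf Q.fiber Y → ∀ x, (S.form α).eval X Y x = θ Y x := by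
  obtain ⟨X, hX, h⟩ := H.exists_section_L (θ := fun β => if β = α then θ else fun _ => 0)
    (fun β => by
      by_cases hβ : β = α
      · simpa only [hβ, if_true] using hθ
      · simpa only [hβ, if_false] using isTensorial_zero)
  refine ⟨X, fun x => H.mem_leaf_of (hX x) fun β hβ q hq => ?_, fun Y hY x => ?_⟩
  · obtain ⟨Y, hY, rfl⟩ := exists_section_apply_eq _ hq
    refine (h β Y hY x).trans ?_
    rw [if_neg hβ]
    rfl
  · rw [h α Y hY x, if_pos rfl]

/-- `L` is the sum of the `L_α`, on the level of smooth sections. -/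
lemma exists_eq_sum_leaf {X : VField E M} (hX : IsSectionOf S.L.fiber X) :
    ∃ P : Fin k → VField E M, (∀ α, IsSectionOf (S.leaf α) (P α)) ∧ X = ∑ α, P α := by
  choose P hP hPX using fun α =>
    H.exists_section_leaf α ((S.form α).isTensorial_evalFun X)
  refine ⟨P, hP, ContMDiffSection.ext fun x => ?_⟩
  have hsum : (∑ α, P α : VField E M) x = ∑ α, P α x := by
    rw [← ContMDiffSection.coeAddHom_apply, map_sum, Finset.sum_apply]
    rfl
  rw [hsum, ← sub_eq_zero]
  refine H.eq_zero_of_mem_L ((S.L.fiber x).sub_mem (hX x)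
    (Submodule.sum_mem _ fun α _ => (S.mem_leaf.1 (hP α x)).1)) fun β q hq => ?_
  obtain ⟨Y, hY, rfl⟩ := exists_section_apply_eq _ hq
  rw [TwoForm.map_sub_left, map_sum, sum_apply,
    Finset.sum_eq_single β (fun α _ hα => (S.mem_leaf.1 (hP α x)).2 β hα.symm _)
      (fun h => absurd (Finset.mem_univ β) h), sub_eq_zero]
  exact (hPX β Y hY x).symm

/-- The isomorphism `i_α^*` of `Q` with the dual of `L_α` is onto, on the level of smooth sections.
For smoothness the preimage has to be paired with every `ω_β` and not only with `ω_α`; the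
isomorphism `J` of `L` with `L_α` along which `ω_β` turns into `ω_α` reduces this to `ω_α`. -/
lemma exists_section_Q (α : Fin k) {θ : VField E M → SmoothFun E M} (hθ : IsTensorial θ) :
    ∃ Z : VField E M, IsSectionOf Q.fiber Z ∧
      ∀ X, IsSectionOf (S.leaf α) X → ∀ x, (S.form α).eval Z X x = θ X x := by
  have hx : ∀ x : M, ∃ v ∈ Q.fiber x, ∀ X : VField E M, IsSectionOf (S.leaf α) X →
      (S.form α).toFun x v (X x) = θ X x := fun x => by
    have : FiniteDimensional ℝ (TangentSpace 𝓘(ℝ, E) x) :=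
      inferInstanceAs (FiniteDimensional ℝ E)
    obtain ⟨φ, hφ⟩ := hθ.exists_linearMap x
    obtain ⟨v, hv, h⟩ := exists_mem_apply_eq_of_summand
      (B := fun β => (S.form β).toLinearMap x) (S.L.finrank_fiber x) (Q.finrank_fiber x)
      (fun v hv hv0 => H.eq_zero_of_mem_L hv hv0) α (-φ)
    refine ⟨v, hv, fun X hX => ?_⟩
    obtain ⟨hXL, hX0⟩ := S.mem_leaf.1 (hX x)
    have h1 : (S.form α).toFun x (X x) v = -φ (X x) := h _ hXL fun γ hγ q _ => hX0 γ hγ q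
    rw [TwoForm.swap, h1, hφ, neg_neg]
  choose z hz hθz using hx
  refine ⟨⟨z, H.contMDiff_of_pairings (fun β X hX => ?_)
    (fun β Y hY => contMDiff_const.congr fun x => H.vanishesOn β x _ (hz x) _ (hY x))⟩, hz,
    fun X hX x => hθz x X hX⟩
  obtain ⟨J, hJ, hJX⟩ := H.exists_section_leaf α ((S.form β).isTensorial_evalFun X)
  refine (θ J).contMDiff.congr fun x => ?_
  rw [← hθz x J hJ, TwoForm.swap, TwoForm.swap _ x (z x) (J x), neg_inj]
  obtain ⟨Y, hY, hYx⟩ := exists_section_apply_eq _ (hz x)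
  rw [← hYx]
  exact (hJX Y hY x).symm

end IsIsotropicComplement

end Structure

end Splitting

/-! ### The connection -/

lemma LinearConnection.ext_cov {E : Type*} [NormedAddCommGroup E] [NormedSpace ℝ E]
    {M : Type*} [TopologicalSpace M] [ChartedSpace E M] [IsManifold 𝓘(ℝ, E) ∞ M]
    {C C' : LinearConnection E M} (h : ∀ V W, C.cov V W = C'.cov V W) : C = C' := by
  obtain ⟨c, _, _, _, _⟩ := C
  obtain ⟨c', _, _, _, _⟩ := C'
  obtain rfl : c = c' := funext fun V => funext fun W => h V W
  rfl

section Connection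

variable {E : Type*} [NormedAddCommGroup E] [NormedSpace ℝ E] [FiniteDimensional ℝ E]
  {M : Type*} [TopologicalSpace M] [T2Space M] [ChartedSpace E M] [IsManifold 𝓘(ℝ, E) ∞ M]
  {n k : ℕ} {S : Structure E M n k} {Q : Distribution E M n}

namespace Structure.IsIsotropicComplement

/-- For sections `Y`, `Y'` of `Q`, the functionals `ψ_β^{YY'}` on `L` are all represented by one
section of `Q`. On `L_β` this is the equality of the preimages `(i_β^*)⁻¹ ψ_β^{YY'}`; on the other
summands `L_α` of `L` both sides vanish. -/
lemma exists_section_Q_psi (H : S.IsIsotropicComplement Q)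
    (hii : ∀ (α : Fin k) (X Y : VField E M), IsSectionOf (S.leaf α) X → IsSectionOf Q.fiber Y →
      ∀ x, bracket X Y x ∈ S.leaf α x ⊔ Q.fiber x)
    (hψ : ∀ Y Y' : VField E M, IsSectionOf Q.fiber Y → IsSectionOf Q.fiber Y' →
      ∀ (α β : Fin k) (Z Z' : VField E M),
        S.IsPreimagePsi Q α Y Y' Z → S.IsPreimagePsi Q β Y Y' Z' → Z = Z')
    {Y Y' : VField E M} (hY : IsSectionOf Q.fiber Y) (hY' : IsSectionOf Q.fiber Y') :
    ∃ Z : VField E M, IsSectionOf Q.fiber Z ∧ ∀ β X, IsSectionOf S.L.fiber X →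
      ∀ x, (S.form β).eval Z X x = (S.form β).psi Y Y' X x := by
  choose Z hZ hZψ using fun α => H.exists_section_Q α ((S.form α).isTensorial_psiFun Y Y')
  -- For `k = 0` there is nothing to represent, and no index `α₀` to start from.
  rcases isEmpty_or_nonempty (Fin k) with hk | ⟨⟨α₀⟩⟩
  · exact ⟨0, isSectionOf_zero _, fun β => hk.elim β⟩
  refine ⟨Z α₀, hZ α₀, fun β X hX x => ?_⟩
  have hZβ : Z α₀ = Z β := hψ Y Y' hY hY' α₀ β _ _ ⟨hZ α₀, hZψ α₀⟩ ⟨hZ β, hZψ β⟩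
  obtain ⟨P, hP, rfl⟩ := H.exists_eq_sum_leaf hX
  let F : VField E M →+ ℝ := AddMonoidHom.mk'
    (fun W => (S.form β).eval (Z α₀) W x - (S.form β).psi Y Y' W x) fun W W' => by
      simp only [TwoForm.eval, VField.add_apply, TwoForm.map_add_right, TwoForm.psi_add_right]
      ring
  rw [← sub_eq_zero]
  change F (∑ α, P α) = 0
  rw [map_sum]
  refine Finset.sum_eq_zero fun α _ => ?_
  change (S.form β).eval (Z α₀) (P α) x - (S.form β).psi Y Y' (P α) x = 0
  rw [sub_eq_zero]
  by_cases hα : α = β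
  · subst hα
    rw [hZβ]
    exact hZψ α (P α) (hP α) x
  · have hPβ : ∀ (y : M) w, (S.form β).toFun y w (P α y) = 0 := fun y w => by
      rw [TwoForm.swap, (S.mem_leaf.1 (hP α y)).2 β (Ne.symm hα), neg_zero]
    have h0 : (S.form β).eval Y' (P α) = fun _ => 0 := funext fun y => hPβ y _
    obtain ⟨l, hl, q, hq, hlq⟩ := Submodule.mem_sup.1 (hii α (P α) Y (hP α) hY x)
    rw [TwoForm.psi, h0, dirDeriv_zero, bracket_swap, ← hlq, TwoForm.map_neg_right,
      TwoForm.map_add_right, H.vanishesOn β x _ (hY' x) _ hq, TwoForm.swap,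
      (S.mem_leaf.1 hl).2 β (Ne.symm hα)]
    simpa only [neg_zero, add_zero, sub_zero] using! hPβ x (Z α₀ x)

variable (H : S.IsIsotropicComplement Q)

/-- The equations for `U = ∇_V W` forced by the conditions on the connection `∇`. They are
symmetric in `L` and `Q`, and determine `U`. -/
def IsCov (V W U : VField E M) : Prop :=
  (∀ α Y, IsSectionOf Q.fiber Y → ∀ x, (S.form α).eval U Y x =
    (S.form α).psi (H.partL V) (H.partL W) Y x +
      (S.form α).toFun x (bracket (H.partQ V) (H.partL W) x) (Y x)) ∧
  (∀ α X, IsSectionOf S.L.fiber X → ∀ x, (S.form α).eval U X x =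
    (S.form α).psi (H.partQ V) (H.partQ W) X x +
      (S.form α).toFun x (bracket (H.partL V) (H.partQ W) x) (X x))

variable {H}

lemma IsCov.unique {V W U U' : VField E M} (h : H.IsCov V W U) (h' : H.IsCov V W U') :
    U = U' :=
  H.eq_of_forall_sections (fun β Y hY x => (h.1 β Y hY x).trans (h'.1 β Y hY x).symm)
    (fun β X hX x => (h.2 β X hX x).trans (h'.2 β X hX x).symm)

variable (H)

lemma toFun_partL (W : VField E M) (β : Fin k) {x : M} {q : TangentSpace 𝓘(ℝ, E) x}
    (hq : q ∈ Q.fiber x) : (S.form β).toFun x (H.partL W x) q = (S.form β).toFun x (W x) q := by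
  conv_rhs => rw [← H.partL_add_partQ W, VField.add_apply, TwoForm.map_add_left,
    H.vanishesOn β x _ (H.partQ_mem W x) _ hq, add_zero]

lemma toFun_partQ (W : VField E M) (β : Fin k) {x : M} {l : TangentSpace 𝓘(ℝ, E) x}
    (hl : l ∈ S.L.fiber x) : (S.form β).toFun x (H.partQ W x) l = (S.form β).toFun x (W x) l := by
  conv_rhs => rw [← H.partL_add_partQ W, VField.add_apply, TwoForm.map_add_left,
    S.vanishesOn β x _ (H.partL_mem W x) _ hl, zero_add]

lemma exists_isCov
    (hB : ∀ Y Y' : VField E M, IsSectionOf Q.fiber Y → IsSectionOf Q.fiber Y' →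
      ∃ Z : VField E M, IsSectionOf Q.fiber Z ∧ ∀ β X, IsSectionOf S.L.fiber X →
        ∀ x, (S.form β).eval Z X x = (S.form β).psi Y Y' X x)
    (V W : VField E M) : ∃ U, H.IsCov V W U := by
  obtain ⟨A, hA, hAψ⟩ := H.exists_section_L fun β =>
    (S.form β).isTensorial_psiFun (H.partL V) (H.partL W)
  obtain ⟨B, hB, hBψ⟩ := hB _ _ (H.partQ_mem V) (H.partQ_mem W)
  let X₁ := lie (H.partQ V) (H.partL W)
  let Y₁ := lie (H.partL V) (H.partQ W)
  refine ⟨A + B + (H.partL X₁ + H.partQ Y₁), fun α Y hY x => ?_, fun α X hX x => ?_⟩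
  · have h1 := hAψ α Y hY x
    have h2 := H.vanishesOn α x _ (hB x) _ (hY x)
    have h3 := H.toFun_partL X₁ α (hY x)
    have h4 := H.vanishesOn α x _ (H.partQ_mem Y₁ x) _ (hY x)
    simp only [TwoForm.eval, VField.add_apply, TwoForm.map_add_left] at h1 ⊢
    rw [h1, h2, h3, h4, add_zero, add_zero]
    rfl
  · have h1 := hBψ α X hX x
    have h2 := S.vanishesOn α x _ (hA x) _ (hX x)
    have h3 := H.toFun_partQ Y₁ α (hX x)
    have h4 := S.vanishesOn α x _ (H.partL_mem X₁ x) _ (hX x)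
    simp only [TwoForm.eval, VField.add_apply, TwoForm.map_add_left] at h1 ⊢
    rw [h1, h2, h3, h4, zero_add, zero_add]
    rfl

variable {H}

lemma IsCov.add_left {V V' W U U' : VField E M} (h : H.IsCov V W U) (h' : H.IsCov V' W U') :
    H.IsCov (V + V') W (U + U') := by
  refine ⟨fun α Y hY x => ?_, fun α X hX x => ?_⟩
  · have h1 := h.1 α Y hY x
    have h2 := h'.1 α Y hY x
    simp only [TwoForm.eval, VField.add_apply, TwoForm.map_add_left, H.parts_add,
      TwoForm.psi_add_left, bracket_add_left] at h1 h2 ⊢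
    linear_combination h1 + h2
  · have h1 := h.2 α X hX x
    have h2 := h'.2 α X hX x
    simp only [TwoForm.eval, VField.add_apply, TwoForm.map_add_left, H.parts_add,
      TwoForm.psi_add_left, bracket_add_left] at h1 h2 ⊢
    linear_combination h1 + h2

lemma IsCov.add_right {V W W' U U' : VField E M} (h : H.IsCov V W U) (h' : H.IsCov V W' U') :
    H.IsCov V (W + W') (U + U') := by
  refine ⟨fun α Y hY x => ?_, fun α X hX x => ?_⟩
  · have h1 := h.1 α Y hY x
    have h2 := h'.1 α Y hY x
    simp only [TwoForm.eval, VField.add_apply, TwoForm.map_add_left, H.parts_add,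
      TwoForm.psi_add_middle, bracket_add_right] at h1 h2 ⊢
    linear_combination h1 + h2
  · have h1 := h.2 α X hX x
    have h2 := h'.2 α X hX x
    simp only [TwoForm.eval, VField.add_apply, TwoForm.map_add_left, H.parts_add,
      TwoForm.psi_add_middle, bracket_add_right] at h1 h2 ⊢
    linear_combination h1 + h2

/-- The derivatives of `f` in the two terms of the equations cancel because `L` and `Q` are
isotropic. -/
lemma IsCov.fsmul_left {V W U : VField E M} (f : SmoothFun E M) (h : H.IsCov V W U) :
    H.IsCov (KSymplectic.fsmul f V) W (KSymplectic.fsmul f U) := by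
  refine ⟨fun α Y hY x => ?_, fun α X hX x => ?_⟩
  · have h1 := h.1 α Y hY x
    have h2 := S.vanishesOn α x _ (H.partL_mem W x) _ (H.partL_mem V x)
    have h3 := H.vanishesOn α x _ (H.partQ_mem V x) _ (hY x)
    simp only [TwoForm.eval, fsmul_apply, TwoForm.map_smul_left, H.parts_fsmul,
      TwoForm.psi_fsmul_left, bracket_fsmul_left, TwoForm.map_sub_left] at h1 ⊢
    rw [h2, h3]
    linear_combination f x * h1
  · have h1 := h.2 α X hX x
    have h2 := H.vanishesOn α x _ (H.partQ_mem W x) _ (H.partQ_mem V x)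
    have h3 := S.vanishesOn α x _ (H.partL_mem V x) _ (hX x)
    simp only [TwoForm.eval, fsmul_apply, TwoForm.map_smul_left, H.parts_fsmul,
      TwoForm.psi_fsmul_left, bracket_fsmul_left, TwoForm.map_sub_left] at h1 ⊢
    rw [h2, h3]
    linear_combination f x * h1

lemma dirDeriv_parts (H : S.IsIsotropicComplement Q) (V : VField E M) (f : M → ℝ) (x : M) :
    dirDeriv V f x = dirDeriv (H.partL V) f x + dirDeriv (H.partQ V) f x := by
  rw [← dirDeriv_add_left, H.partL_add_partQ]

lemma IsCov.leibniz {V W U : VField E M} (f : SmoothFun E M) (h : H.IsCov V W U) :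
    H.IsCov V (KSymplectic.fsmul f W)
      (KSymplectic.fsmul f U + KSymplectic.fsmul (dirDerivFun V f) W) := by
  refine ⟨fun α Y hY x => ?_, fun α X hX x => ?_⟩
  · have h1 := h.1 α Y hY x
    have h2 := H.toFun_partL W α (hY x)
    have h3 := H.dirDeriv_parts V f x
    simp only [TwoForm.eval, VField.add_apply, fsmul_apply, TwoForm.map_smul_left, H.parts_fsmul,
      TwoForm.psi_fsmul_middle, bracket_fsmul_right, TwoForm.map_add_left] at h1 ⊢
    rw [dirDerivFun_apply, h2, h3]
    linear_combination f x * h1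
  · have h1 := h.2 α X hX x
    have h2 := H.toFun_partQ W α (hX x)
    have h3 := H.dirDeriv_parts V f x
    simp only [TwoForm.eval, VField.add_apply, fsmul_apply, TwoForm.map_smul_left, H.parts_fsmul,
      TwoForm.psi_fsmul_middle, bracket_fsmul_right, TwoForm.map_add_left] at h1 ⊢
    rw [dirDerivFun_apply, h2, h3]
    linear_combination f x * h1

lemma exists_connection (hcov : ∀ V W : VField E M, ∃ U, H.IsCov V W U) :
    ∃ C : LinearConnection E M, ∀ V W, H.IsCov V W (C.cov V W) := by
  choose c hc using hcov
  refine ⟨⟨c, fun V V' W => (hc _ _).unique ((hc V W).add_left (hc V' W)),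
    fun f V W => (hc _ _).unique ((hc V W).fsmul_left f),
    fun V W W' => (hc _ _).unique ((hc V W).add_right (hc V W')),
    fun f V W x => ?_⟩, hc⟩
  rw [(hc _ _).unique ((hc V W).leibniz f)]
  rfl

end Structure.IsIsotropicComplement

end Connection

section Characterization

variable {E : Type*} [NormedAddCommGroup E] [NormedSpace ℝ E] [FiniteDimensional ℝ E]
  {M : Type*} [TopologicalSpace M] [T2Space M] [ChartedSpace E M] [IsManifold 𝓘(ℝ, E) ∞ M]
  {n k : ℕ} {S : Structure E M n k} {Q : Distribution E M n}

/-! ### The properties of the connection, and uniqueness -/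

lemma LinearConnection.Preserves.sum_leaf (H : S.IsIsotropicComplement Q)
    {C : LinearConnection E M} (hC : ∀ α, C.Preserves (S.leaf α)) : C.Preserves S.L.fiber := by
  intro V X hX x
  obtain ⟨P, hP, rfl⟩ := H.exists_eq_sum_leaf hX
  let F : VField E M →+ TangentSpace 𝓘(ℝ, E) x := AddMonoidHom.mk' (fun W => C.cov V W x)
    fun W W' => by rw [C.add_right, VField.add_apply]
  change F (∑ α, P α) ∈ _
  rw [map_sum]
  exact Submodule.sum_mem _ fun α _ => (S.mem_leaf.1 (hC α V (P α) (hP α) x)).1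

namespace Structure.IsIsotropicComplement

variable {H : S.IsIsotropicComplement Q}

lemma IsCov.mem_L {V X U : VField E M} (h : H.IsCov V X U) (hX : IsSectionOf S.L.fiber X) :
    IsSectionOf S.L.fiber U := by
  have h0 : H.partQ U = 0 := ContMDiffSection.ext fun x =>
    H.eq_zero_of_mem_Q (H.partQ_mem U x) fun β l hl => by
      obtain ⟨X', hX', rfl⟩ := exists_section_apply_eq _ hl
      have h1 := h.2 β X' hX' x
      rw [(H.parts_of_mem_L hX).2, TwoForm.psi_eq_zero _ _ _ fun y => Submodule.zero_mem _] at h1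
      rw [H.toFun_partQ U β hl]
      refine h1.trans ?_
      have h2 : bracket (H.partL V) (0 : VField E M) x = 0 :=
        congrFun VectorField.mlieBracket_zero_right x
      rw [h2, TwoForm.map_zero_left, add_zero]
  rw [← H.partL_add_partQ U, h0, add_zero]
  exact H.partL_mem U

lemma IsCov.mem_Q {V Y U : VField E M} (h : H.IsCov V Y U) (hY : IsSectionOf Q.fiber Y) :
    IsSectionOf Q.fiber U := by
  have h0 : H.partL U = 0 := ContMDiffSection.ext fun x =>
    H.eq_zero_of_mem_L (H.partL_mem U x) fun β q hq => by
      obtain ⟨Y', hY', rfl⟩ := exists_section_apply_eq _ hq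
      have h1 := h.1 β Y' hY' x
      rw [(H.parts_of_mem_Q hY).1, TwoForm.psi_eq_zero _ _ _ fun y => Submodule.zero_mem _] at h1
      rw [H.toFun_partL U β hq]
      refine h1.trans ?_
      have h2 : bracket (H.partQ V) (0 : VField E M) x = 0 :=
        congrFun VectorField.mlieBracket_zero_right x
      rw [h2, TwoForm.map_zero_left, add_zero]
  rw [← H.partL_add_partQ U, h0, zero_add]
  exact H.partQ_mem U

lemma IsCov.mem_leaf
    (hii : ∀ (α : Fin k) (X Y : VField E M), IsSectionOf (S.leaf α) X → IsSectionOf Q.fiber Y →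
      ∀ x, bracket X Y x ∈ S.leaf α x ⊔ Q.fiber x)
    {α : Fin k} {V X U : VField E M} (h : H.IsCov V X U) (hX : IsSectionOf (S.leaf α) X) :
    IsSectionOf (S.leaf α) U := by
  have hXL : IsSectionOf S.L.fiber X := fun x => (S.mem_leaf.1 (hX x)).1
  refine fun x => H.mem_leaf_of (h.mem_L hXL x) fun β hβ q hq => ?_
  obtain ⟨Y, hY, rfl⟩ := exists_section_apply_eq _ hq
  refine (h.1 β Y hY x).trans ?_
  obtain ⟨l, hl, q, hq', hlq⟩ := Submodule.mem_sup.1 (hii α X _ hX (H.partQ_mem V) x)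
  rw [(H.parts_of_mem_L hXL).1, TwoForm.psi_eq_zero _ _ _ fun y =>
      (S.form β).mem_charSpace.2 ((S.mem_leaf.1 (hX y)).2 β hβ),
    bracket_swap, ← hlq, TwoForm.map_neg_left, TwoForm.map_add_left,
    (S.mem_leaf.1 hl).2 β hβ, H.vanishesOn β x _ hq' _ hq, add_zero, neg_zero, add_zero]

/-- `ω_α(W, W')` splits into the pairings of the `L`-component of one field with the `Q`-component
of the other. -/
lemma eval_eq_parts (H : S.IsIsotropicComplement Q) (α : Fin k) (W W' : VField E M) (x : M) :
    (S.form α).eval W W' x =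
      (S.form α).eval (H.partL W) (H.partQ W') x + (S.form α).eval (H.partQ W) (H.partL W') x := by
  have h1 := H.toFun_partL W α (H.partQ_mem W' x)
  have h2 := H.toFun_partQ W α (H.partL_mem W' x)
  rw [TwoForm.eval, TwoForm.eval, TwoForm.eval, h1, h2, ← TwoForm.map_add_right,
    ← VField.add_apply, add_comm (H.partQ W'), H.partL_add_partQ]

lemma covTwoForm_eq_zero {C : LinearConnection E M} (hC : ∀ V W, H.IsCov V W (C.cov V W))
    (α : Fin k) (V W W' : VField E M) (x : M) : C.covTwoForm (S.form α) V W W' x = 0 := by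
  have key : ∀ W W' U : VField E M, H.IsCov V W U → (S.form α).eval U W' x =
      (S.form α).psi (H.partL V) (H.partL W) (H.partQ W') x +
        (S.form α).toFun x (bracket (H.partQ V) (H.partL W) x) (H.partQ W' x) +
      ((S.form α).psi (H.partQ V) (H.partQ W) (H.partL W') x +
        (S.form α).toFun x (bracket (H.partL V) (H.partQ W) x) (H.partL W' x)) :=
    fun W W' U hU => by
      rw [← hU.1 α _ (H.partQ_mem W') x, ← hU.2 α _ (H.partL_mem W') x, TwoForm.eval, TwoForm.eval,
        TwoForm.eval, ← TwoForm.map_add_right, ← VField.add_apply, add_comm (H.partQ W'),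
        H.partL_add_partQ]
  have h1 := key W W' _ (hC V W)
  have h2 : (S.form α).eval W (C.cov V W') x = -(S.form α).eval (C.cov V W') W x :=
    (S.form α).swap x _ _
  rw [key W' W _ (hC V W')] at h2
  have h3 : (S.form α).eval W W' = fun x =>
      (S.form α).eval (H.partL W) (H.partQ W') x + (S.form α).eval (H.partQ W) (H.partL W') x :=
    funext (H.eval_eq_parts α W W')
  -- The derivatives of `ω(W, W')` come in two orders of the arguments.
  have hneg : ∀ X Y Z : VField E M,
      dirDeriv Z ((S.form α).eval X Y) x = -dirDeriv Z ((S.form α).eval Y X) x := fun X Y Z => by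
    have hXY : (fun y => (S.form α).eval X Y y + (S.form α).eval Y X y) = fun _ => 0 :=
      funext fun y => by
        simp only [TwoForm.eval]
        rw [TwoForm.swap, neg_add_cancel]
    have h := dirDeriv_add ((S.form α).contMDiff_eval X Y) ((S.form α).contMDiff_eval Y X) Z x
    rw [hXY, dirDeriv_zero] at h
    linarith
  rw [LinearConnection.covTwoForm, h1, h2, h3, dirDeriv_add ((S.form α).contMDiff_eval _ _)
    ((S.form α).contMDiff_eval _ _), H.dirDeriv_parts, H.dirDeriv_parts V]
  simp only [TwoForm.psi]
  rw [hneg (H.partQ W') (H.partL W), hneg (H.partL W') (H.partQ W),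
    TwoForm.swap _ x (H.partL W x), TwoForm.swap _ x (H.partQ W x),
    TwoForm.swap _ x (H.partL W' x), TwoForm.swap _ x (H.partQ W' x)]
  ring

lemma torsion_eq_zero {C : LinearConnection E M} (hC : ∀ V W, H.IsCov V W (C.cov V W))
    {X Y : VField E M} (hX : IsSectionOf S.L.fiber X) (hY : IsSectionOf Q.fiber Y) (x : M) :
    C.torsion X Y x = 0 := by
  obtain ⟨hXL, hXQ⟩ := H.parts_of_mem_L hX
  obtain ⟨hYL, hYQ⟩ := H.parts_of_mem_Q hY
  have hU := (hC X Y).mem_Q hY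
  have hU' := (hC Y X).mem_L hX
  have hψ : ∀ β (Z V : VField E M), (S.form β).psi Z 0 V x = 0 := fun β Z V =>
    TwoForm.psi_eq_zero _ _ _ (fun y => Submodule.zero_mem _) x
  refine H.eq_zero (fun β l hl => ?_) (fun β q hq => ?_)
  · obtain ⟨X', hX', rfl⟩ := exists_section_apply_eq _ hl
    have h1 := (hC X Y).2 β X' hX' x
    have h2 := S.vanishesOn β x _ (hU' x) _ (hX' x)
    have h3 : (S.form β).psi 0 Y X' x = 0 := by
      have := (S.form β).psi_add_left 0 0 Y X' x
      rw [add_zero] at this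
      linarith
    rw [hXL, hXQ, hYQ, h3, zero_add] at h1
    rw [LinearConnection.torsion, TwoForm.map_sub_left, TwoForm.map_sub_left, h2]
    exact sub_eq_zero.2 ((sub_zero _).trans h1)
  · obtain ⟨Y', hY', rfl⟩ := exists_section_apply_eq _ hq
    have h1 := (hC Y X).1 β Y' hY' x
    have h2 := H.vanishesOn β x _ (hU x) _ (hY' x)
    have h3 : (S.form β).psi 0 X Y' x = 0 := by
      have := (S.form β).psi_add_left 0 0 X Y' x
      rw [add_zero] at this
      linarith
    rw [hYL, hXL, hYQ, h3, zero_add] at h1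
    rw [LinearConnection.torsion, TwoForm.map_sub_left, TwoForm.map_sub_left, h2,
      bracket_swap, TwoForm.map_neg_left, ← h1]
    simp only [TwoForm.eval]
    ring

/-- A connection with the required properties satisfies the equations for `∇_V W`: vanishing
torsion between `L` and `Q` turns the derivatives `∇_X Y`, `∇_Y X` into brackets, and parallelism
of the forms then gives `∇_X X'` and `∇_Y Y'`. -/
lemma isCov_of_properties (H : S.IsIsotropicComplement Q) {C : LinearConnection E M}
    (hL : C.Preserves S.L.fiber) (hQ : C.Preserves Q.fiber)
    (hω : ∀ (α : Fin k) (V W W' : VField E M) (x : M), C.covTwoForm (S.form α) V W W' x = 0)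
    (hT : ∀ X Y : VField E M, IsSectionOf S.L.fiber X → IsSectionOf Q.fiber Y →
      ∀ x, C.torsion X Y x = 0)
    (V W : VField E M) : H.IsCov V W (C.cov V W) := by
  have hT' : ∀ {X Y : VField E M}, IsSectionOf S.L.fiber X → IsSectionOf Q.fiber Y →
      ∀ x, bracket X Y x = C.cov X Y x - C.cov Y X x := fun hX hY x =>
    (sub_eq_zero.1 (hT _ _ hX hY x)).symm
  have hsplit : ∀ x, C.cov V W x = (C.cov (H.partL V) (H.partL W) x +
      C.cov (H.partL V) (H.partQ W) x) +
      (C.cov (H.partQ V) (H.partL W) x + C.cov (H.partQ V) (H.partQ W) x) := fun x => by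
    simp only [← VField.add_apply, ← C.add_right, ← C.add_left, H.partL_add_partQ]
  have hVL := H.partL_mem V
  have hVQ := H.partQ_mem V
  have hWL := H.partL_mem W
  have hWQ := H.partQ_mem W
  refine ⟨fun α Y hY x => ?_, fun α X hX x => ?_⟩
  · have h := hω α (H.partL V) (H.partL W) Y x
    have h1 := H.vanishesOn α x _ (hQ (H.partL V) _ hWQ x) _ (hY x)
    have h2 := H.vanishesOn α x _ (hQ (H.partQ V) _ hWQ x) _ (hY x)
    have h3 := S.vanishesOn α x _ (hWL x) _ (hL Y _ hVL x)
    have h4 := H.vanishesOn α x _ (hQ (H.partL W) _ hVQ x) _ (hY x)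
    rw [TwoForm.psi, hT' hVL hY, bracket_swap, hT' hWL hVQ]
    simp only [LinearConnection.covTwoForm, TwoForm.eval, hsplit, TwoForm.map_add_left,
      TwoForm.map_sub_right, TwoForm.map_neg_left, TwoForm.map_sub_left] at h ⊢
    rw [h1, h2, h3, h4]
    linear_combination -h
  · have h := hω α (H.partQ V) (H.partQ W) X x
    have h1 := S.vanishesOn α x _ (hL (H.partL V) _ hWL x) _ (hX x)
    have h2 := S.vanishesOn α x _ (hL (H.partQ V) _ hWL x) _ (hX x)
    have h3 := H.vanishesOn α x _ (hWQ x) _ (hQ X _ hVQ x)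
    have h4 := S.vanishesOn α x _ (hL (H.partQ W) _ hVL x) _ (hX x)
    rw [TwoForm.psi, bracket_swap (H.partQ V), hT' hX hVQ, hT' hVL hWQ]
    simp only [LinearConnection.covTwoForm, TwoForm.eval, hsplit, TwoForm.map_add_left,
      TwoForm.map_sub_right, TwoForm.map_neg_right, TwoForm.map_sub_left] at h ⊢
    rw [h1, h2, h3, h4]
    linear_combination -h

end Structure.IsIsotropicComplement

end Characterization

end KSymplectic

theorem mainTheorem1 {E : Type*} [NormedAddCommGroup E] [NormedSpace ℝ E] [FiniteDimensional ℝ E]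
    {M : Type*} [TopologicalSpace M] [T2Space M] [ChartedSpace E M] [IsManifold 𝓘(ℝ, E) ∞ M]
    {n k : ℕ} (S : KSymplectic.Structure E M n k) (Q : KSymplectic.Distribution E M n)
    (hQ : Q.IsIntegrable)
    (hcompl : ∀ x, IsCompl (S.L.fiber x) (Q.fiber x))
    (hi : ∀ α, (S.form α).VanishesOn Q.fiber)
    (hii : ∀ (α : Fin k) (X Y : KSymplectic.VField E M),
      KSymplectic.IsSectionOf (S.leaf α) X → KSymplectic.IsSectionOf Q.fiber Y →
        ∀ x, KSymplectic.bracket X Y x ∈ S.leaf α x ⊔ Q.fiber x)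
    (hψ : ∀ Y Y' : KSymplectic.VField E M,
      KSymplectic.IsSectionOf Q.fiber Y → KSymplectic.IsSectionOf Q.fiber Y' →
        ∀ (α β : Fin k) (Z Z' : KSymplectic.VField E M),
          S.IsPreimagePsi Q α Y Y' Z → S.IsPreimagePsi Q β Y Y' Z' → Z = Z') :
    ∃! C : KSymplectic.LinearConnection E M,
      ((∀ α, C.Preserves (S.leaf α)) ∧ C.Preserves Q.fiber) ∧
      (∀ (α : Fin k) (V W W' : KSymplectic.VField E M) (x : M),
        C.covTwoForm (S.form α) V W W' x = 0) ∧
      (∀ X Y : KSymplectic.VField E M,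
        KSymplectic.IsSectionOf S.L.fiber X → KSymplectic.IsSectionOf Q.fiber Y →
          ∀ x, C.torsion X Y x = 0) := by
  have H : S.IsIsotropicComplement Q := ⟨hcompl, hi⟩
  obtain ⟨C, hC⟩ := H.exists_connection <| H.exists_isCov fun _ _ hY hY' =>
    H.exists_section_Q_psi hii hψ hY hY'
  refine ⟨C, ⟨⟨fun α V X hX => (hC V X).mem_leaf hii hX, fun V Y hY => (hC V Y).mem_Q hY⟩,
    H.covTwoForm_eq_zero hC, fun X Y hX hY x => H.torsion_eq_zero hC hX hY x⟩, ?_⟩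
  rintro C' ⟨⟨hL, hQ'⟩, hω, hT⟩
  exact KSymplectic.LinearConnection.ext_cov fun V W =>
    (H.isCov_of_properties (.sum_leaf H hL) hQ' hω hT V W).unique (hC V W)
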